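/- **Theorem (Weak Structure Theorem).** *Setting.* Let $k$ be a commutative ring, $A$ and $L$ (associative unital) $k$-algebras, $\mathcal C$ an $A$-coring with coproduct $\Delta_{\mathcal C}(c)=c^{(1)}\otimes_A c^{(2)}$ and counit $\epsilon_{\mathcal C}$, and $\mathcal D$ an $L$-coring with coproduct $d\mapsto d_{(1)}\otimes_L d_{(2)}$. (Corings are coassociative and counital, and so are all comodules below.) A right $\mathcal C$-comodule $M$ has coaction $\varrho^M(m)=m^{[0]}\otimes_A m^{[1]}$; $\mathcal M^{\mathcal C}$ denotes the category of right $\mathcal C$-comodules. Let $\mathcal D$ be a *right extension* of $\mathcal C$: $\mathcal C$ is an $A$-$L$ bimodule (extending its left $A$-module structure) and a $\mathcal C$-$\mathcal D$ bicomodule, with left coaction $\Delta_{\mathcal C}$ and a right $\mathcal D$-coaction $\tau_{\mathcal C}:c\mapsto c_{[0]}\otimes_L c_{[1]}$; that is, $\tau_{\mathcal C}$ is left $A$-linear, and $\Delta_{\mathcal C}$ is right $L$-linear and right $\mathcal D$-colinear. Every right $\mathcal C$-comodule $M$ is a right $L$-module through $ml=m^{[0]}\epsilon_{\mathcal C}(m^{[1]}l)$.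 Assume the extension is *pure*: for every right $\mathcal C$-comodule $M$ the equaliser $$M\xrightarrow{\ \varrho^M\ } M\otimes_A\mathcal C\ \rightrightarrows\ M\otimes_A\mathcal C\otimes_A\mathcal C$$ of $\varrho^M\otimes_A\mathcal C$ and $M\otimes_A\Delta_{\mathcal C}$ in the category of right $L$-modules is preserved by $-\otimes_L(\mathcal D\otimes_L\mathcal D)$. Then every right $\mathcal C$-comodule $M$ is a right $\mathcal D$-comodule via $\tau_M(m)=m^{[0]}\epsilon_{\mathcal C}(m^{[1]}{}_{[0]})\otimes_L m^{[1]}{}_{[1]}$, i.e. $\tau_M(m)$ is the unique element of $M\otimes_L\mathcal D$ with $(\varrho^M\otimes_L\mathcal D)(\tau_M(m))=m^{[0]}\otimes_A m^{[1]}{}_{[0]}\otimes_L m^{[1]}{}_{[1]}$. Let $\Sigma$ be an $L$-$\mathcal C$ bicomodule, i.e. an $L$-$A$ bimodule and a right $\mathcal C$-comodule whose $\mathcal C$-coaction is left $L$-linear. Let $T=\mathrm{End}^{\mathcal C}(\Sigma)$, with composition as product, viewed as an $L$-$L$ bimodule via $L\to T$, $l\mapsto(x\mapsto lx)$, and let $\Sigma^*=\mathrm{Hom}_A(\Sigma,A)$,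 with $(a\xi l)(x)=a\,\xi(lx)$. Consider - the algebra ${}_L\mathrm{Hom}_L(\mathcal D,T)$ of bimodule maps with product $(vv')(d)=v(d_{(1)})v'(d_{(2)})$ and unit $d\mapsto\epsilon_{\mathcal D}(d)1_T$; - the left ${}_L\mathrm{Hom}_L(\mathcal D,T)$-module ${}_L\mathrm{Hom}^{\mathcal D}(\mathcal D,\Sigma)$ of left $L$-linear right $\mathcal D$-colinear maps, with $(vp)(d)=v(d_{(1)})(p(d_{(2)}))$; - the right ${}_L\mathrm{Hom}_L(\mathcal D,T)$-module $$\widetilde Q=\{q\in{}_A\mathrm{Hom}_L(\mathcal C,\Sigma^*)\mid c^{(1)}q(c^{(2)})(x)=q(c)(x^{[0]})\,x^{[1]}\ \text{ for all } x\in\Sigma,\ c\in\mathcal C\},$$ with $(qv)(c)=q(c_{[0]})\circ v(c_{[1]})$; - the $k$-module ${}^{\mathcal C}\mathrm{End}^{\mathcal D}(\mathcal C)$ of left $\mathcal C$-colinear and right $\mathcal D$-colinear endomorphisms of $\mathcal C$. The connecting map $\blacklozenge$ of the Morita context $\widetilde{\mathbb M}(\Sigma)$ is the well-defined map $$\blacklozenge:\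 \widetilde Q\otimes_{{}_L\mathrm{Hom}_L(\mathcal D,T)}{}_L\mathrm{Hom}^{\mathcal D}(\mathcal D,\Sigma)\to{}^{\mathcal C}\mathrm{End}^{\mathcal D}(\mathcal C),\qquad (q\blacklozenge p)(c)=c^{(1)}\,q(c^{(2)}{}_{[0]})\big(p(c^{(2)}{}_{[1]})\big).$$ *Claim.* If $\blacklozenge$ is surjective, then: 1. The functor $\mathrm{Hom}^{\mathcal C}(\Sigma,-):\mathcal M^{\mathcal C}\to\mathcal M_T$, where $T$ acts by composition, is fully faithful. 2. $\Sigma$ is a Galois $\mathcal C$-comodule: for every right $A$-module $N$ the map $$\mathrm{can}_N:\mathrm{Hom}_A(\Sigma,N)\otimes_T\Sigma\to N\otimes_A\mathcal C,\qquad \phi\otimes x\mapsto\phi(x^{[0]})\otimes_A x^{[1]}$$ is bijective. 3. For every right $\mathcal C$-comodule $M$ the counit $$\varepsilon_M:\mathrm{Hom}^{\mathcal C}(\Sigma,M)\otimes_T\Sigma\to M,\qquad \varphi\otimes x\mapsto\varphi(x)$$ of the adjunction between $-\otimes_T\Sigma:\mathcal M_T\to\mathcal M^{\mathcal C}$ and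 $\mathrm{Hom}^{\mathcal C}(\Sigma,-)$ is an isomorphism of $\mathcal C$-comodules, and its inverse is $\mathrm{can}_M^{-1}\circ\varrho^M$. More precisely, the map $\mathrm{Hom}^{\mathcal C}(\Sigma,M)\otimes_T\Sigma\to\mathrm{Hom}_A(\Sigma,M)\otimes_T\Sigma$ induced by the inclusion is injective, and $\mathrm{can}_M^{-1}\circ\varrho^M$ takes its values in the image of this map. -/

import Mathlib

universe u

set_option linter.unusedVariables false

open MulOpposite CategoryTheory

namespace CoringMorita

noncomputable section

/-! ### Tensor products over a noncommutative ring

Right modules over `R` are modules over `Rᵐᵒᵖ`; thus `m r` is written `op r • m`. -/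

section TensorProduct

/-- The subgroup of `M ⊗[ℤ] N` generated by the elements `m r ⊗ n - m ⊗ r n`. -/
def balancedRel (R M N : Type*) [Ring R] [AddCommGroup M] [AddCommGroup N]
    [Module Rᵐᵒᵖ M] [Module R N] : AddSubgroup (TensorProduct ℤ M N) :=
  AddSubgroup.closure {z | ∃ (r : R) (m : M) (n : N),
    z = TensorProduct.tmul ℤ (op r • m) n - TensorProduct.tmul ℤ m (r • n)}

/-- The tensor product `M ⊗_R N` of a right `R`-module `M` and a left `R`-module `N`. -/
def BTensor (R M N : Type*) [Ring R] [AddCommGroup M] [AddCommGroup N]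
    [Module Rᵐᵒᵖ M] [Module R N] : Type _ :=
  TensorProduct ℤ M N ⧸ balancedRel R M N

namespace BTensor

variable {R S M N P : Type*} [Ring R] [Ring S] [AddCommGroup M] [AddCommGroup N] [AddCommGroup P]
  [Module Rᵐᵒᵖ M] [Module R N]

instance : AddCommGroup (BTensor R M N) :=
  inferInstanceAs (AddCommGroup (TensorProduct ℤ M N ⧸ balancedRel R M N))

variable (R) in
/-- The pure tensor `m ⊗_R n`. -/
def tmul (m : M) (n : N) : BTensor R M N :=
  QuotientAddGroup.mk' (balancedRel R M N) (TensorProduct.tmul ℤ m n)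

theorem add_tmul (m m' : M) (n : N) : tmul R (m + m') n = tmul R m n + tmul R m' n := by
  simp only [tmul, TensorProduct.add_tmul]; exact map_add _ _ _

theorem tmul_add (m : M) (n n' : N) : tmul R m (n + n') = tmul R m n + tmul R m n' := by
  simp only [tmul, TensorProduct.tmul_add]; exact map_add _ _ _

theorem smul_tmul (r : R) (m : M) (n : N) : tmul R (op r • m) n = tmul R m (r • n) := by
  refine (QuotientAddGroup.eq_iff_sub_mem).2 ?_
  exact AddSubgroup.subset_closure ⟨r, m, n, rfl⟩

/-- The additive map out of `M ⊗_R N` given by a biadditive `R`-balanced map. -/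
def lift (f : M → N → P) (h₁ : ∀ m m' n, f (m + m') n = f m n + f m' n)
    (h₂ : ∀ m n n', f m (n + n') = f m n + f m n')
    (h₃ : ∀ (r : R) m n, f (op r • m) n = f m (r • n)) : BTensor R M N →+ P :=
  QuotientAddGroup.lift (balancedRel R M N)
    (TensorProduct.liftAddHom
      (AddMonoidHom.mk' (fun m => AddMonoidHom.mk' (f m) (h₂ m))
        (fun m m' => by ext n; exact h₁ m m' n))
      (fun z m n => by
        rw [map_zsmul, AddMonoidHom.zsmul_apply, map_zsmul]))
    (by
      refine (AddSubgroup.closure_le _).2 ?_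
      rintro _ ⟨r, m, n, rfl⟩
      refine (map_sub _ _ _).trans (sub_eq_zero.2 ?_)
      exact h₃ r m n)

@[simp] theorem lift_tmul (f : M → N → P) (h₁ h₂) (h₃ : ∀ (r : R) m n, f (op r • m) n = f m (r • n))
    (m : M) (n : N) : lift f h₁ h₂ h₃ (tmul R m n) = f m n := rfl

@[elab_as_elim]
theorem induction_on {p : BTensor R M N → Prop} (z : BTensor R M N)
    (tmul : ∀ m n, p (tmul R m n)) (add : ∀ x y, p x → p y → p (x + y)) : p z := by
  induction z using QuotientAddGroup.induction_on with
  | H z =>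
    induction z using TensorProduct.induction_on with
    | zero =>
      have h := tmul 0 0
      simp only [BTensor.tmul, TensorProduct.zero_tmul] at h
      exact h
    | tmul m n => exact tmul m n
    | add x y hx hy => exact add _ _ hx hy

theorem addHom_ext {f g : BTensor R M N →+ P} (h : ∀ m n, f (tmul R m n) = g (tmul R m n)) :
    f = g := by
  ext z
  induction z using induction_on with
  | tmul m n => exact h m n
  | add x y hx hy => rw [map_add, map_add, hx, hy]

theorem eq_of_tmul (f g : BTensor R M N → P)
    (hf : ∀ x y, f (x + y) = f x + f y) (hg : ∀ x y, g (x + y) = g x + g y)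
    (h : ∀ m n, f (tmul R m n) = g (tmul R m n)) (z : BTensor R M N) : f z = g z := by
  induction z using induction_on with
  | tmul m n => exact h m n
  | add x y hx hy => rw [hf, hg, hx, hy]

section Map

variable {M' N' M'' N'' : Type*} [AddCommGroup M'] [AddCommGroup N'] [AddCommGroup M'']
  [AddCommGroup N''] [Module Rᵐᵒᵖ M'] [Module R N'] [Module Rᵐᵒᵖ M''] [Module R N'']

/-- The map `f ⊗_R g`. -/
def map (f : M →ₗ[Rᵐᵒᵖ] M') (g : N →ₗ[R] N') : BTensor R M N →+ BTensor R M' N' :=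
  lift (fun m n => tmul R (f m) (g n)) (fun m m' n => by rw [map_add, add_tmul])
    (fun m n n' => by rw [map_add, tmul_add]) (fun r m n => by rw [map_smul, map_smul, smul_tmul])

@[simp] theorem map_tmul (f : M →ₗ[Rᵐᵒᵖ] M') (g : N →ₗ[R] N') (m : M) (n : N) :
    map f g (tmul R m n) = tmul R (f m) (g n) := rfl

theorem map_map (f : M →ₗ[Rᵐᵒᵖ] M') (g : N →ₗ[R] N') (f' : M' →ₗ[Rᵐᵒᵖ] M'') (g' : N' →ₗ[R] N'')
    (z : BTensor R M N) : map f' g' (map f g z) = map (f'.comp f) (g'.comp g) z := by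
  induction z using induction_on with
  | tmul m n => rfl
  | add x y hx hy => simp only [map_add, hx, hy]

theorem map_id (z : BTensor R M N) :
    map (LinearMap.id : M →ₗ[Rᵐᵒᵖ] M) (LinearMap.id : N →ₗ[R] N) z = z := by
  induction z using induction_on with
  | tmul m n => rfl
  | add x y hx hy => simp only [map_add, hx, hy]

theorem map_add_left (f f' : M →ₗ[Rᵐᵒᵖ] M') (g : N →ₗ[R] N') (z : BTensor R M N) :
    map (f + f') g z = map f g z + map f' g z := by
  induction z using induction_on with
  | tmul m n => simp only [map_tmul, LinearMap.add_apply, add_tmul]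
  | add x y hx hy => rw [map_add, map_add, map_add, hx, hy]; abel

theorem map_zero_left (g : N →ₗ[R] N') (z : BTensor R M N) :
    map (0 : M →ₗ[Rᵐᵒᵖ] M') g z = 0 := by
  have h := map_add_left (0 : M →ₗ[Rᵐᵒᵖ] M') 0 g z
  rwa [add_zero, left_eq_add] at h

theorem map_neg_left (f : M →ₗ[Rᵐᵒᵖ] M') (g : N →ₗ[R] N') (z : BTensor R M N) :
    map (-f) g z = -map f g z := by
  rw [eq_neg_iff_add_eq_zero, ← map_add_left, neg_add_cancel, map_zero_left]

end Map

/-- `s (m ⊗ n) = (s m) ⊗ n` for an `S`-`R` bimodule `M`. -/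
instance leftModule [Module S M] [SMulCommClass S Rᵐᵒᵖ M] : Module S (BTensor R M N) where
  smul s := lift (fun m n => tmul R (s • m) n) (fun m m' n => by rw [smul_add, add_tmul])
    (fun m n n' => tmul_add _ _ _) (fun r m n => by rw [smul_comm, smul_tmul])
  one_smul z := by
    induction z using induction_on with
    | tmul m n => exact congrArg (fun x => tmul R x n) (one_smul S m)
    | add x y hx hy => exact (map_add _ _ _).trans (congrArg₂ _ hx hy)
  mul_smul s t z := by
    induction z using induction_on with
    | tmul m n => exact congrArg (fun x => tmul R x n) (mul_smul s t m)
    | add x y hx hy =>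
      refine (map_add _ _ _).trans ((congrArg₂ _ hx hy).trans ?_)
      exact ((congrArg _ (map_add _ _ _)).trans (map_add _ _ _)).symm
  smul_zero s := map_zero _
  smul_add s := map_add _
  add_smul s t z := by
    induction z using induction_on with
    | tmul m n => exact (congrArg (fun x => tmul R x n) (add_smul s t m)).trans (add_tmul _ _ _)
    | add x y hx hy =>
      refine (map_add _ _ _).trans ((congrArg₂ _ hx hy).trans ?_)
      refine (add_add_add_comm _ _ _ _).trans ?_
      exact (congrArg₂ _ (map_add _ _ _) (map_add _ _ _)).symm
  zero_smul z := by
    induction z using induction_on with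
    | tmul m n =>
      refine (congrArg (fun x => tmul R x n) (zero_smul S m)).trans ?_
      have h := add_tmul (R := R) (0 : M) 0 n
      rwa [add_zero, left_eq_add] at h
    | add x y hx hy => exact (map_add _ _ _).trans ((congrArg₂ _ hx hy).trans (add_zero 0))

/-- `(m ⊗ n) s = m ⊗ (n s)` for an `R`-`S` bimodule `N`. -/
instance rightModule [Module Sᵐᵒᵖ N] [SMulCommClass R Sᵐᵒᵖ N] :
    Module Sᵐᵒᵖ (BTensor R M N) where
  smul s := lift (fun m n => tmul R m (s • n)) (fun m m' n => add_tmul _ _ _)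
    (fun m n n' => by rw [smul_add, tmul_add]) (fun r m n => by rw [← smul_comm r s, smul_tmul])
  one_smul z := by
    induction z using induction_on with
    | tmul m n => exact congrArg (fun x => tmul R m x) (one_smul Sᵐᵒᵖ n)
    | add x y hx hy => exact (map_add _ _ _).trans (congrArg₂ _ hx hy)
  mul_smul s t z := by
    induction z using induction_on with
    | tmul m n => exact congrArg (fun x => tmul R m x) (mul_smul s t n)
    | add x y hx hy =>
      refine (map_add _ _ _).trans ((congrArg₂ _ hx hy).trans ?_)
      exact ((congrArg _ (map_add _ _ _)).trans (map_add _ _ _)).symm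
  smul_zero s := map_zero _
  smul_add s := map_add _
  add_smul s t z := by
    induction z using induction_on with
    | tmul m n => exact (congrArg (fun x => tmul R m x) (add_smul s t n)).trans (tmul_add _ _ _)
    | add x y hx hy =>
      refine (map_add _ _ _).trans ((congrArg₂ _ hx hy).trans ?_)
      refine (add_add_add_comm _ _ _ _).trans ?_
      exact (congrArg₂ _ (map_add _ _ _) (map_add _ _ _)).symm
  zero_smul z := by
    induction z using induction_on with
    | tmul m n =>
      refine (congrArg (fun x => tmul R m x) (zero_smul Sᵐᵒᵖ n)).trans ?_
      have h := tmul_add (R := R) m (0 : N) 0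
      rwa [add_zero, left_eq_add] at h
    | add x y hx hy => exact (map_add _ _ _).trans ((congrArg₂ _ hx hy).trans (add_zero 0))

@[simp] theorem smul_left [Module S M] [SMulCommClass S Rᵐᵒᵖ M] (s : S) (m : M) (n : N) :
    s • tmul R m n = tmul R (s • m) n := rfl

@[simp] theorem smul_right [Module Sᵐᵒᵖ N] [SMulCommClass R Sᵐᵒᵖ N] (s : Sᵐᵒᵖ) (m : M) (n : N) :
    s • tmul R m n = tmul R m (s • n) := rfl

instance bimodule {S' : Type*} [Ring S'] [Module S M] [SMulCommClass S Rᵐᵒᵖ M]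
    [Module S'ᵐᵒᵖ N] [SMulCommClass R S'ᵐᵒᵖ N] : SMulCommClass S S'ᵐᵒᵖ (BTensor R M N) where
  smul_comm s t z := by
    induction z using induction_on with
    | tmul m n => rfl
    | add x y hx hy => simp only [smul_add, hx, hy]

/-- `M ⊗_R N → M`, `m ⊗ n ↦ m f(n)`, for a left linear form `f` on `N`. -/
def evalRight (f : N →ₗ[R] R) : BTensor R M N →+ M :=
  lift (fun m n => op (f n) • m) (fun m m' n => smul_add _ _ _)
    (fun m n n' => by rw [map_add, MulOpposite.op_add, add_smul])
    (fun r m n => by rw [map_smul, smul_eq_mul, op_mul, mul_smul])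

/-- `M ⊗_R N → N`, `m ⊗ n ↦ f(m) n`, for a right linear form `f` on `M`. -/
def evalLeft (f : M →ₗ[Rᵐᵒᵖ] R) : BTensor R M N →+ N :=
  lift (fun m n => f m • n) (fun m m' n => by rw [map_add, add_smul])
    (fun m n n' => smul_add _ _ _)
    (fun r m n => by rw [map_smul, op_smul_eq_mul, mul_smul])

@[simp] theorem evalRight_tmul (f : N →ₗ[R] R) (m : M) (n : N) :
    evalRight f (tmul R m n) = op (f n) • m := rfl

@[simp] theorem evalLeft_tmul (f : M →ₗ[Rᵐᵒᵖ] R) (m : M) (n : N) :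
    evalLeft f (tmul R m n) = f m • n := rfl

section Assoc

variable {B Q : Type*} [AddCommGroup B] [AddCommGroup Q] [Module R B] [Module Sᵐᵒᵖ B] [SMulCommClass R Sᵐᵒᵖ B]
  [Module S Q]

/-- `M ⊗_R B → M ⊗_R (B ⊗_S Q)`, `m ⊗ b ↦ m ⊗ (b ⊗ p)`. -/
def insRight (p : Q) : BTensor R M B →+ BTensor R M (BTensor S B Q) :=
  lift (fun m b => tmul R m (tmul S b p)) (fun m m' b => add_tmul _ _ _)
    (fun m b b' => (congrArg (tmul R m) (add_tmul b b' p)).trans (tmul_add _ _ _))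
    (fun r m b => smul_tmul r m (tmul S b p))

/-- `B ⊗_S Q → (M ⊗_R B) ⊗_S Q`, `b ⊗ p ↦ (m ⊗ b) ⊗ p`. -/
def insLeft (m : M) : BTensor S B Q →+ BTensor S (BTensor R M B) Q :=
  lift (fun b p => tmul S (tmul R m b) p)
    (fun b b' p => (congrArg (fun x => tmul S x p) (tmul_add m b b')).trans (add_tmul _ _ _))
    (fun b p p' => tmul_add _ _ _)
    (fun s b p => smul_tmul s (tmul R m b) p)

@[simp] theorem insRight_tmul (p : Q) (m : M) (b : B) :
    insRight p (tmul R m b) = tmul R m (tmul S b p) := rfl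

@[simp] theorem insLeft_tmul (m : M) (b : B) (p : Q) :
    insLeft m (tmul S b p) = tmul S (tmul R m b) p := rfl

variable (M B Q) in
/-- `(M ⊗_R B) ⊗_S Q → M ⊗_R (B ⊗_S Q)`, `(m ⊗ b) ⊗ p ↦ m ⊗ (b ⊗ p)`. -/
def assocHom : BTensor S (BTensor R M B) Q →+ BTensor R M (BTensor S B Q) :=
  lift (fun z p => insRight p z)
    (fun z z' p => map_add (insRight p) z z')
    (fun z p p' => DFunLike.congr_fun (f := insRight (p + p')) (g := insRight p + insRight p')
      (addHom_ext fun m b =>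
        (congrArg (tmul R m) (tmul_add b p p')).trans (tmul_add m _ _)) z)
    (fun s z p => by
      induction z using induction_on with
      | tmul m b => exact congrArg (fun x => tmul R m x) (smul_tmul s b p)
      | add x y hx hy =>
        rw [smul_add, map_add (insRight p), map_add (insRight (s • p)), hx, hy])

variable (M B Q) in
/-- `M ⊗_R (B ⊗_S Q) → (M ⊗_R B) ⊗_S Q`, `m ⊗ (b ⊗ p) ↦ (m ⊗ b) ⊗ p`. -/
def assocInv : BTensor R M (BTensor S B Q) →+ BTensor S (BTensor R M B) Q :=
  lift (fun m z => insLeft m z)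
    (fun m m' z => DFunLike.congr_fun (f := insLeft (m + m')) (g := insLeft m + insLeft m')
      (addHom_ext fun b p =>
        (congrArg (fun x => tmul S x p) (add_tmul m m' b)).trans (add_tmul _ _ p)) z)
    (fun m z z' => map_add (insLeft m) z z')
    (fun r m z => by
      induction z using induction_on with
      | tmul b p => exact congrArg (fun x => tmul S x p) (smul_tmul r m b)
      | add x y hx hy =>
        rw [smul_add, map_add (insLeft m), map_add (insLeft (op r • m)), hx, hy])

@[simp] theorem assocHom_tmul (m : M) (b : B) (p : Q) :
    assocHom M B Q (tmul S (tmul R m b) p) = tmul R m (tmul S b p) := rfl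

@[simp] theorem assocInv_tmul (m : M) (b : B) (p : Q) :
    assocInv M B Q (tmul R m (tmul S b p)) = tmul S (tmul R m b) p := rfl

@[elab_as_elim]
theorem induction_left {p : BTensor S (BTensor R M B) Q → Prop} (z : BTensor S (BTensor R M B) Q)
    (tmul : ∀ m b x, p (tmul S (BTensor.tmul R m b) x)) (add : ∀ x y, p x → p y → p (x + y)) :
    p z := by
  induction z using induction_on with
  | tmul y x =>
    induction y using induction_on with
    | tmul m b => exact tmul m b x
    | add y y' h h' => rw [add_tmul]; exact add _ _ h h'
  | add x y hx hy => exact add x y hx hy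

@[elab_as_elim]
theorem induction_right {p : BTensor R M (BTensor S B Q) → Prop} (z : BTensor R M (BTensor S B Q))
    (tmul : ∀ m b x, p (tmul R m (BTensor.tmul S b x))) (add : ∀ x y, p x → p y → p (x + y)) :
    p z := by
  induction z using induction_on with
  | tmul m y =>
    induction y using induction_on with
    | tmul b x => exact tmul m b x
    | add y y' h h' => rw [tmul_add]; exact add _ _ h h'
  | add x y hx hy => exact add x y hx hy

variable (M B Q) in
/-- The associativity isomorphism `(M ⊗_R B) ⊗_S Q ≅ M ⊗_R (B ⊗_S Q)`. -/
def assoc : BTensor S (BTensor R M B) Q ≃+ BTensor R M (BTensor S B Q) where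
  toFun := assocHom M B Q
  invFun := assocInv M B Q
  left_inv z := by
    induction z using induction_left with
    | tmul m b x => rfl
    | add x y hx hy => simp only [map_add, hx, hy]
  right_inv z := by
    induction z using induction_right with
    | tmul m b x => rfl
    | add x y hx hy => simp only [map_add, hx, hy]
  map_add' := map_add _

@[simp] theorem assoc_tmul (m : M) (b : B) (p : Q) :
    assoc M B Q (tmul S (tmul R m b) p) = tmul R m (tmul S b p) := rfl

@[simp] theorem assoc_symm_tmul (m : M) (b : B) (p : Q) :
    (assoc M B Q).symm (tmul R m (tmul S b p)) = tmul S (tmul R m b) p := rfl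

end Assoc

end BTensor

end TensorProduct

/-! ### Corings and their right comodules -/

/-- A coring over the ring `A`: a comonoid in the monoidal category of `A`-`A` bimodules. -/
structure Coring (A : Type u) [Ring A] where
  carrier : Type u
  [addCommGroup : AddCommGroup carrier]
  [leftModule : Module A carrier]
  [rightModule : Module Aᵐᵒᵖ carrier]
  [smulCommClass : SMulCommClass A Aᵐᵒᵖ carrier]
  /-- The coproduct `Δ`. -/
  comul : carrier →ₗ[A] BTensor A carrier carrier
  comul_op_smul : ∀ (a : A) (c : carrier), comul (op a • c) = op a • comul c
  /-- The counit `ε`. -/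
  counit : carrier →ₗ[A] A
  counit_op_smul : ∀ (a : A) (c : carrier), counit (op a • c) = counit c * a
  coassoc : ∀ c, BTensor.assoc carrier carrier carrier
    (BTensor.map ⟨⟨comul, map_add comul⟩, fun a c => comul_op_smul a.unop c⟩ LinearMap.id
      (comul c)) = BTensor.map LinearMap.id comul (comul c)
  evalLeft_counit : ∀ c, BTensor.evalLeft
    (⟨⟨counit, map_add counit⟩, fun a c => counit_op_smul a.unop c⟩ : carrier →ₗ[Aᵐᵒᵖ] A)
    (comul c) = c
  evalRight_counit : ∀ c, BTensor.evalRight counit (comul c) = c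

namespace Coring

instance (A : Type u) [Ring A] : CoeSort (Coring A) (Type u) := ⟨carrier⟩

attribute [instance] addCommGroup leftModule rightModule smulCommClass

variable {A : Type u} [Ring A] (C : Coring A)

/-- The coproduct as a map of right modules. -/
def comulR : C →ₗ[Aᵐᵒᵖ] BTensor A C C :=
  ⟨⟨C.comul, map_add C.comul⟩, fun a c => C.comul_op_smul a.unop c⟩

/-- The counit as a map of right modules. -/
def counitR : C →ₗ[Aᵐᵒᵖ] A :=
  ⟨⟨C.counit, map_add C.counit⟩, fun a c => C.counit_op_smul a.unop c⟩

@[simp] theorem comulR_apply (c : C) : C.comulR c = C.comul c := rfl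

@[simp] theorem counitR_apply (c : C) : C.counitR c = C.counit c := rfl

end Coring

/-- A right comodule `(M, ϱ)` of the `A`-coring `C`. -/
structure Comod {A : Type u} [Ring A] (C : Coring A) where
  carrier : Type u
  [addCommGroup : AddCommGroup carrier]
  [rightModule : Module Aᵐᵒᵖ carrier]
  /-- The coaction `ϱ`. -/
  coact : carrier →ₗ[Aᵐᵒᵖ] BTensor A carrier C
  coassoc : ∀ m, BTensor.assoc carrier C C (BTensor.map coact LinearMap.id (coact m)) =
    BTensor.map LinearMap.id C.comul (coact m)
  evalRight_counit : ∀ m, BTensor.evalRight C.counit (coact m) = m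

namespace Comod

variable {A : Type u} [Ring A] {C : Coring A}

instance : CoeSort (Comod C) (Type u) := ⟨carrier⟩

attribute [instance] addCommGroup rightModule

/-- A morphism of right `C`-comodules: a right `A`-linear map that commutes with the coactions. -/
@[ext]
structure Hom (M N : Comod C) where
  toLin : M →ₗ[Aᵐᵒᵖ] N
  comm : ∀ m, BTensor.map toLin LinearMap.id (M.coact m) = N.coact (toLin m)

/-- The category of right `C`-comodules. -/
instance : Category (Comod C) where
  Hom := Hom
  id M := ⟨LinearMap.id, fun m => BTensor.map_id _⟩
  comp f g := ⟨g.toLin.comp f.toLin, fun m => by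
    rw [LinearMap.comp_apply, ← g.comm, ← f.comm, BTensor.map_map]; rfl⟩

/-- The right `A`-linear map underlying a morphism of comodules. -/
def lin {M N : Comod C} (f : M ⟶ N) : M →ₗ[Aᵐᵒᵖ] N := Hom.toLin f

/-- The morphism of comodules given by a colinear map. -/
def ofLin {M N : Comod C} (f : M →ₗ[Aᵐᵒᵖ] N)
    (hf : ∀ m, BTensor.map f LinearMap.id (M.coact m) = N.coact (f m)) : M ⟶ N := ⟨f, hf⟩

variable {M N P : Comod C}

theorem lin_comm (f : M ⟶ N) (m : M) :
    BTensor.map (lin f) LinearMap.id (M.coact m) = N.coact (lin f m) := Hom.comm f m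

@[simp] theorem lin_ofLin (f : M →ₗ[Aᵐᵒᵖ] N) (hf) : lin (ofLin f hf : M ⟶ N) = f := rfl

@[simp] theorem lin_id : lin (𝟙 M) = LinearMap.id := rfl

@[simp] theorem lin_comp (f : M ⟶ N) (g : N ⟶ P) : lin (f ≫ g) = (lin g).comp (lin f) := rfl

theorem lin_injective : Function.Injective (lin : (M ⟶ N) → (M →ₗ[Aᵐᵒᵖ] N)) :=
  fun _ _ h => Hom.ext h

theorem hom_ext {f g : M ⟶ N} (h : ∀ m, lin f m = lin g m) : f = g :=
  lin_injective (LinearMap.ext h)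

/-- The colinear maps as a subgroup of the right `A`-linear maps. -/
def colin (M N : Comod C) : AddSubgroup (M →ₗ[Aᵐᵒᵖ] N) where
  carrier := {f | ∀ m, BTensor.map f LinearMap.id (M.coact m) = N.coact (f m)}
  add_mem' {f g} hf hg m := by
    rw [BTensor.map_add_left, hf m, hg m, LinearMap.add_apply, map_add]
  zero_mem' m := by rw [BTensor.map_zero_left, LinearMap.zero_apply, map_zero]
  neg_mem' {f} hf m := by rw [BTensor.map_neg_left, hf m, LinearMap.neg_apply, map_neg]

/-- Colinear maps are added pointwise. -/
instance : AddCommGroup (M ⟶ N) :=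
  Equiv.addCommGroup (β := colin M N)
    ⟨fun f => ⟨lin f, lin_comm f⟩, fun f => ofLin f.1 f.2, fun _ => rfl, fun _ => rfl⟩

@[simp] theorem lin_add (f g : M ⟶ N) : lin (f + g) = lin f + lin g := rfl

@[simp] theorem lin_zero : lin (0 : M ⟶ N) = 0 := rfl

instance : Preadditive (Comod C) where
  add_comp _ _ _ f g h := hom_ext fun m => by
    simp only [lin_comp, lin_add, LinearMap.comp_apply, LinearMap.add_apply, map_add]
  comp_add _ _ _ f g h := rfl

/-- `T = End^C(M)` acts on `M` from the left; the product of `T` is the composition of maps. -/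
instance endModule (M : Comod C) : Module (End M) M where
  smul t m := lin (t : M ⟶ M) m
  one_smul m := rfl
  mul_smul s t m := rfl
  smul_zero t := map_zero (lin (t : M ⟶ M))
  smul_add t := map_add (lin (t : M ⟶ M))
  add_smul s t m := rfl
  zero_smul m := rfl

theorem end_smul_def (t : End M) (m : M) : t • m = lin (t : M ⟶ M) m := rfl

instance (M : Comod C) : SMulCommClass (End M) Aᵐᵒᵖ M where
  smul_comm t a m := map_smul (lin (t : M ⟶ M)) a m

/-- `Hom_A(M, X)` is a right `End^C(M)`-module through composition, `(φ t)(m) = φ(t(m))`. -/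
instance homModule (M : Comod C) (X : Type*) [AddCommGroup X] [Module Aᵐᵒᵖ X] :
    Module (End M)ᵐᵒᵖ (M →ₗ[Aᵐᵒᵖ] X) where
  smul t φ := φ.comp (lin (t.unop : M ⟶ M))
  one_smul φ := rfl
  mul_smul s t φ := rfl
  smul_zero t := rfl
  smul_add t φ ψ := rfl
  add_smul s t φ := LinearMap.ext fun m => map_add φ (lin s.unop m) (lin t.unop m)
  zero_smul φ := LinearMap.ext fun m => map_zero φ

theorem op_smul_hom_apply {X : Type*} [AddCommGroup X] [Module Aᵐᵒᵖ X] (t : End M)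
    (φ : M →ₗ[Aᵐᵒᵖ] X) (m : M) : (op t • φ) m = φ (lin (t : M ⟶ M) m) := rfl

/-- The functor `Hom^C(S, -)` from right `C`-comodules to right modules over `T = End^C(S)`,
where `T` acts by `(φ t)(x) = φ(t(x))`. -/
abbrev homFunctor (S : Comod C) : Comod C ⥤ ModuleCat.{u} (End S)ᵐᵒᵖ :=
  preadditiveCoyonedaObj S

end Comod

namespace BTensor

variable {R S : Type*} [Ring R] [Ring S] {M M' B Q Q' : Type*}
  [AddCommGroup M] [AddCommGroup M'] [AddCommGroup B] [AddCommGroup Q] [AddCommGroup Q']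
  [Module Rᵐᵒᵖ M] [Module Rᵐᵒᵖ M'] [Module R B] [Module Sᵐᵒᵖ B] [SMulCommClass R Sᵐᵒᵖ B]
  [Module S Q] [Module S Q']

variable (S B) in
/-- `f ⊗_R B` as a map of right `S`-modules. -/
def mapR (f : M →ₗ[Rᵐᵒᵖ] M') : BTensor R M B →ₗ[Sᵐᵒᵖ] BTensor R M' B :=
  ⟨⟨map f LinearMap.id, (map f LinearMap.id).map_add⟩, fun s z => by
    induction z using induction_on with
    | tmul m b => rfl
    | add x y hx hy =>
      simp only [RingHom.id_apply] at hx hy ⊢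
      rw [smul_add, AddMonoidHom.map_add, hx, hy, AddMonoidHom.map_add, smul_add]⟩

variable (R B) in
/-- `B ⊗_S g` as a map of left `R`-modules. -/
def mapL (g : Q →ₗ[S] Q') : BTensor S B Q →ₗ[R] BTensor S B Q' :=
  ⟨⟨map LinearMap.id g, (map LinearMap.id g).map_add⟩, fun s z => by
    induction z using induction_on with
    | tmul m b => rfl
    | add x y hx hy =>
      simp only [RingHom.id_apply] at hx hy ⊢
      rw [smul_add, AddMonoidHom.map_add, hx, hy, AddMonoidHom.map_add, smul_add]⟩

@[simp] theorem mapR_apply (f : M →ₗ[Rᵐᵒᵖ] M') (z : BTensor R M B) :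
    mapR S B f z = map f LinearMap.id z := rfl

@[simp] theorem mapL_apply (g : Q →ₗ[S] Q') (z : BTensor S B Q) :
    mapL R B g z = map LinearMap.id g z := rfl

theorem assoc_map (f : M →ₗ[Rᵐᵒᵖ] M') (g : Q →ₗ[S] Q') (z : BTensor S (BTensor R M B) Q) :
    assoc M' B Q' (map (mapR S B f) g z) = map f (mapL R B g) (assoc M B Q z) := by
  induction z using induction_left with
  | tmul m b q => rfl
  | add x y hx hy => rw [AddMonoidHom.map_add, map_add, map_add, AddMonoidHom.map_add, hx, hy]

theorem mapL_id : mapL R B (LinearMap.id : Q →ₗ[S] Q) = LinearMap.id :=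
  LinearMap.ext fun z => map_id z

end BTensor

namespace Comod

variable {A : Type u} [Ring A] {C : Coring A}

/-- The coaction of `S` is left linear over `End^C(S)`. -/
def coactL (S : Comod C) : S →ₗ[End S] BTensor A S C :=
  ⟨⟨S.coact, map_add S.coact⟩, fun t x => by
    have key : ∀ z : BTensor A S C, BTensor.map (lin (t : S ⟶ S)) LinearMap.id z = t • z := by
      intro z
      induction z using BTensor.induction_on with
      | tmul m c => rfl
      | add x y hx hy => rw [AddMonoidHom.map_add, hx, hy, smul_add]
    exact (lin_comm (t : S ⟶ S) x).symm.trans (key _)⟩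

section Ind

variable (S : Comod C) (W : Type u) [AddCommGroup W] [Module (End S)ᵐᵒᵖ W]

/-- The right `A`-linear map `S → W ⊗_T S`, `x ↦ w ⊗ x`. -/
def insW (w : W) : S →ₗ[Aᵐᵒᵖ] BTensor (End S) W S where
  toFun x := BTensor.tmul (End S) w x
  map_add' x y := BTensor.tmul_add w x y
  map_smul' a x := rfl

/-- The coaction `w ⊗ x ↦ (w ⊗ x^{[0]}) ⊗ x^{[1]}` on `W ⊗_T S`. -/
def indCoact : BTensor (End S) W S →ₗ[Aᵐᵒᵖ] BTensor A (BTensor (End S) W S) C :=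
  ⟨⟨fun z => (BTensor.assoc W S C).symm (BTensor.map LinearMap.id S.coactL z), fun z z' => by
    rw [AddMonoidHom.map_add, AddEquiv.map_add]⟩, fun a z => by
      induction z using BTensor.induction_on with
      | tmul w x =>
        have key : ∀ y : BTensor A S C, (BTensor.assoc W S C).symm (BTensor.tmul (End S) w (a • y)) =
            a • (BTensor.assoc W S C).symm (BTensor.tmul (End S) w y) := by
          intro y
          induction y using BTensor.induction_on with
          | tmul m c => rfl
          | add x y hx hy =>
            rw [smul_add, BTensor.tmul_add, BTensor.tmul_add, AddEquiv.map_add, AddEquiv.map_add,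
              smul_add, hx, hy]
        refine Eq.trans ?_ (key (S.coact x))
        exact congrArg (fun y => (BTensor.assoc W S C).symm (BTensor.tmul (End S) w y))
          (map_smul S.coact a x)
      | add x y hx hy =>
        simp only [RingHom.id_apply] at hx hy ⊢
        rw [smul_add, AddMonoidHom.map_add, AddEquiv.map_add, hx, hy, AddMonoidHom.map_add,
          AddEquiv.map_add, smul_add]⟩

theorem indCoact_tmul (w : W) (x : S) :
    indCoact S W (BTensor.tmul (End S) w x) =
      BTensor.map (insW S W w) LinearMap.id (S.coact x) := by
  have key : ∀ y : BTensor A S C, (BTensor.assoc W S C).symm (BTensor.tmul (End S) w y) =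
      BTensor.map (insW S W w) LinearMap.id y := by
    intro y
    induction y using BTensor.induction_on with
    | tmul m c => rfl
    | add x y hx hy => rw [BTensor.tmul_add, AddEquiv.map_add, AddMonoidHom.map_add, hx, hy]
  exact key _

/-- The right `C`-comodule `W ⊗_T S`, for a right module `W` over `T = End^C(S)`. -/
def indObj : Comod C where
  carrier := BTensor (End S) W S
  coact := indCoact S W
  coassoc z := by
    induction z using BTensor.induction_on with
    | tmul w x =>
      have h : (indCoact S W).comp (insW S W w) =
          (BTensor.mapR A C (insW S W w)).comp S.coact :=
        LinearMap.ext fun x => indCoact_tmul S W w x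
      rw [indCoact_tmul, BTensor.map_map, BTensor.map_map, h, LinearMap.comp_id,
        ← LinearMap.comp_id (LinearMap.id : C →ₗ[A] C), ← BTensor.map_map, BTensor.assoc_map,
        S.coassoc, BTensor.mapL_id, BTensor.map_map]
      rfl
    | add x y hx hy => simp only [map_add, hx, hy]
  evalRight_counit z := by
    induction z using BTensor.induction_on with
    | tmul w x =>
      have key : ∀ y : BTensor A S C, BTensor.evalRight C.counit
          (BTensor.map (insW S W w) LinearMap.id y) =
            BTensor.tmul (End S) w (BTensor.evalRight C.counit y) := by
        intro y
        induction y using BTensor.induction_on with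
        | tmul m c => rfl
        | add x y hx hy => rw [map_add, map_add, map_add, BTensor.tmul_add, hx, hy]
      rw [indCoact_tmul, key, S.evalRight_counit]
    | add x y hx hy => simp only [map_add, hx, hy]

end Ind

/-- The functor `- ⊗_T S` from right modules over `T = End^C(S)` to right `C`-comodules. -/
def indFunctor (S : Comod C) : ModuleCat.{u} (End S)ᵐᵒᵖ ⥤ Comod C where
  obj W := indObj S W
  map {W W'} f := ofLin (M := indObj S W) (N := indObj S W') (BTensor.mapR A S f.hom) <|
    BTensor.eq_of_tmul _ _
      (fun x y => (congrArg _ (map_add (indCoact S W) x y)).trans (map_add _ _ _))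
      (fun x y => (congrArg _ (map_add (BTensor.mapR A S f.hom) x y)).trans
        (map_add (indCoact S W') _ _))
      (fun w x => by
        refine (congrArg _ (indCoact_tmul S W w x)).trans ?_
        exact (BTensor.map_map _ _ _ _ _).trans (indCoact_tmul S W' (f.hom w) x).symm)
  map_id W := hom_ext (BTensor.map_id (M := W) (N := S))
  map_comp f g := hom_ext fun z =>
    (BTensor.map_map f.hom LinearMap.id g.hom (LinearMap.id : S →ₗ[End S] S) z).symm

/-- The map `Hom^C(S, M) ⊗_T S → M`, `φ ⊗ x ↦ φ(x)`. -/
def evAdd (S M : Comod C) : BTensor (End S) (S ⟶ M) S →+ M :=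
  BTensor.lift (fun (φ : S ⟶ M) x => lin φ x)
    (fun φ ψ x => rfl) (fun φ x y => map_add (lin φ) x y) (fun t φ x => rfl)

/-- The map `Hom^C(S, M) ⊗_T S → M`, `φ ⊗ x ↦ φ(x)`, is right `A`-linear. -/
def evLin (S M : Comod C) : BTensor (End S) (S ⟶ M) S →ₗ[Aᵐᵒᵖ] M where
  toFun := evAdd S M
  map_add' := (evAdd S M).map_add
  map_smul' a := BTensor.eq_of_tmul (fun z => evAdd S M (a • z)) (fun z => a • evAdd S M z)
    (fun x y => (congrArg _ (smul_add a x y)).trans ((evAdd S M).map_add _ _))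
    (fun x y => (congrArg _ ((evAdd S M).map_add _ _)).trans (smul_add _ _ _))
    (fun φ x => map_smul (lin φ) a x)

/-- The evaluation map `Hom^C(S, M) ⊗_T S → M`, `φ ⊗ x ↦ φ(x)`, as a morphism of comodules. -/
def ev (S M : Comod C) : (indFunctor S).obj ((homFunctor S).obj M) ⟶ M :=
  ofLin (M := indObj S (S ⟶ M)) (evLin S M) <|
    BTensor.eq_of_tmul _ _
      (fun x y => (congrArg _ (map_add (indCoact S (S ⟶ M)) x y)).trans (map_add _ _ _))
      (fun x y => (congrArg _ (map_add (evLin S M) x y)).trans (map_add M.coact _ _))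
      (fun φ x => by
        refine (congrArg _ (indCoact_tmul S (S ⟶ M) φ x)).trans ?_
        exact (BTensor.map_map _ _ _ _ _).trans (lin_comm φ x))

theorem ev_tmul (S M : Comod C) (φ : S ⟶ M) (x : S) :
    lin (ev S M) (BTensor.tmul (End S) (M := (homFunctor S).obj M) φ x) = lin φ x := rfl

/-- The adjunction between `- ⊗_T S` and `Hom^C(S, -)`, with unit `w ↦ (x ↦ w ⊗ x)` and counit
`φ ⊗ x ↦ φ(x)`. -/
def indAdj (S : Comod C) : indFunctor S ⊣ homFunctor S :=
  Adjunction.mkOfUnitCounit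
    { unit :=
        { app W := ModuleCat.ofHom
            { toFun w := (ofLin (insW S W w) fun x => (indCoact_tmul S W w x).symm :
                S ⟶ indObj S W)
              map_add' w w' := hom_ext fun x => BTensor.add_tmul w w' x
              map_smul' t w := hom_ext fun x => BTensor.smul_tmul t.unop w x }
          naturality W W' f := by ext w; rfl }
      counit :=
        { app M := ev S M
          naturality M N f := hom_ext <| BTensor.eq_of_tmul _ _
            (map_add (lin ((homFunctor S ⋙ indFunctor S).map f ≫ ev S N)))
            (map_add (lin (ev S M ≫ f))) (fun φ x => rfl) }
      left_triangle := by
        ext W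
        exact hom_ext <| BTensor.eq_of_tmul _ _ (fun x y => map_add (lin _) x y)
          (fun x y => rfl) (fun w x => rfl)
      right_triangle := by
        ext M φ
        rfl }

/-- The canonical map `can_N : Hom_A(S, N) ⊗_T S → N ⊗_A C`,
`φ ⊗ x ↦ φ(x^{[0]}) ⊗ x^{[1]}`, for a right `A`-module `N`. -/
def can (S : Comod C) (N : Type u) [AddCommGroup N] [Module Aᵐᵒᵖ N] :
    BTensor (End S) (S →ₗ[Aᵐᵒᵖ] N) S →+ BTensor A N C :=
  BTensor.lift (fun φ x => BTensor.map φ LinearMap.id (S.coact x))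
    (fun φ ψ x => by
      generalize S.coact x = z
      induction z using BTensor.induction_on with
      | tmul m d => simp only [BTensor.map_tmul, LinearMap.add_apply, BTensor.add_tmul]
      | add x y hx hy => simp only [map_add, hx, hy]; abel)
    (fun φ x y => by rw [map_add, map_add])
    (fun t φ x => by
      rw [end_smul_def, ← lin_comm (t : S ⟶ S) x, BTensor.map_map]
      rfl)

/-- `S` is a Galois comodule: `can_N` is bijective for every right `A`-module `N`. -/
def IsGalois (S : Comod C) : Prop :=
  ∀ (N : Type u) [AddCommGroup N] [Module Aᵐᵒᵖ N], Function.Bijective (can S N)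

/-- The inverse of `can_N` for a Galois comodule. -/
def canInv {S : Comod C} (h : S.IsGalois) (N : Type u) [AddCommGroup N] [Module Aᵐᵒᵖ N] :
    BTensor A N C → BTensor (End S) (S →ₗ[Aᵐᵒᵖ] N) S :=
  (Equiv.ofBijective (can S N) (h N)).symm

/-- The map `Hom^C(S, M) ⊗_T S → Hom_A(S, M) ⊗_T S` induced by the inclusion
`Hom^C(S, M) ⊆ Hom_A(S, M)`. -/
def incl (S M : Comod C) :
    (indFunctor S).obj ((homFunctor S).obj M) → BTensor (End S) (S →ₗ[Aᵐᵒᵖ] M) S :=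
  BTensor.map (M := (homFunctor S).obj M)
    { toFun := fun φ : S ⟶ M => lin φ
      map_add' := fun φ ψ => rfl
      map_smul' := fun t φ => rfl } LinearMap.id

end Comod

/-! ### Right extensions of corings -/

/-- The diagram `X → Y ⇉ Z` is an equaliser. -/
def IsEqualizer {X Y Z : Type*} (f : X → Y) (g h : Y → Z) : Prop :=
  Function.Injective f ∧ ∀ y, g y = h y ↔ ∃ x, f x = y

/-- The `L`-coring `D` is a right extension of the `A`-coring `C`: the `A`-`L` bimodule `C` is a
`C`-`D` bicomodule through the regular left coaction `Δ_C` and a right coaction `τ`. -/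
structure RightExtension {A L : Type u} [Ring A] [Ring L] (C : Coring A) (D : Coring L)
    [Module Lᵐᵒᵖ C] [SMulCommClass A Lᵐᵒᵖ C] where
  comul_op_smul : ∀ (l : L) (c : C), C.comul (op l • c) = op l • C.comul c
  /-- The right `D`-coaction `τ` on `C`, which is left `A`-linear. -/
  coact : C →ₗ[A] BTensor L C D
  coact_op_smul : ∀ (l : L) (c : C), coact (op l • c) = op l • coact c
  coassoc : ∀ c : C, BTensor.assoc C D D
    (BTensor.map ⟨⟨coact, map_add coact⟩, fun l c => coact_op_smul l.unop c⟩ LinearMap.id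
      (coact c)) = BTensor.map LinearMap.id D.comul (coact c)
  evalRight_counit : ∀ c : C, BTensor.evalRight D.counit (coact c) = c
  /-- The coproduct of `C` is right `D`-colinear. -/
  comul_coact : ∀ c : C, BTensor.assoc C C D
    (BTensor.map ⟨⟨C.comul, map_add C.comul⟩, fun l c => comul_op_smul l.unop c⟩ LinearMap.id
      (coact c)) = BTensor.map LinearMap.id coact (C.comul c)

namespace RightExtension

variable {A L : Type u} [Ring A] [Ring L] {C : Coring A} {D : Coring L}
  [Module Lᵐᵒᵖ C] [SMulCommClass A Lᵐᵒᵖ C]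

/-- The coproduct of `C` as a right `L`-linear map. -/
def comulL (E : RightExtension C D) : C →ₗ[Lᵐᵒᵖ] BTensor A C C :=
  ⟨⟨C.comul, map_add C.comul⟩, fun l c => E.comul_op_smul l.unop c⟩

/-- The `D`-coaction of `C` as a right `L`-linear map. -/
def coactL (E : RightExtension C D) : C →ₗ[Lᵐᵒᵖ] BTensor L C D :=
  ⟨⟨E.coact, map_add E.coact⟩, fun l c => E.coact_op_smul l.unop c⟩

@[simp] theorem comulL_apply (E : RightExtension C D) (c : C) : E.comulL c = C.comul c := rfl

@[simp] theorem coactL_apply (E : RightExtension C D) (c : C) : E.coactL c = E.coact c := rfl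

/-- The left `A`-linear form `c ↦ ε(c l)` on `C`. -/
def counitSMul (C : Coring A) [Module Lᵐᵒᵖ C] [SMulCommClass A Lᵐᵒᵖ C] (l : Lᵐᵒᵖ) : C →ₗ[A] A where
  toFun c := C.counit (l • c)
  map_add' c d := by rw [smul_add, map_add]
  map_smul' a c := by rw [← smul_comm a l c, map_smul, RingHom.id_apply]

theorem evalRight_comul (E : RightExtension C D) (l : Lᵐᵒᵖ) (c : C) :
    BTensor.evalRight (counitSMul C l) (C.comul c) = l • c := by
  have key : ∀ z : BTensor A C C, BTensor.evalRight (counitSMul C l) z =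
      BTensor.evalRight C.counit (l • z) := BTensor.eq_of_tmul _ _
    (fun x y => map_add _ _ _) (fun x y => by rw [smul_add, map_add]) (fun _ _ => rfl)
  have h := E.comul_op_smul l.unop c
  rw [op_unop] at h
  rw [key, ← h, C.evalRight_counit]

/-- `C ⊗_A C → C`, `c ⊗ d ↦ c f(d)`, as a left `A`-linear map. -/
def evalRightL (f : C →ₗ[A] A) : BTensor A C C →ₗ[A] C where
  toFun := BTensor.evalRight f
  map_add' := map_add _
  map_smul' a := BTensor.eq_of_tmul _ _ (fun x y => by rw [smul_add, map_add])
    (fun x y => by rw [map_add, smul_add]) (fun c d => (smul_comm a (op (f d)) c).symm)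

@[simp] theorem evalRightL_apply (f : C →ₗ[A] A) (z : BTensor A C C) :
    evalRightL f z = BTensor.evalRight f z := rfl

/-- `ϱ(m^{[0]} f(m^{[1]})) = m^{[0]} ⊗ m^{[1](1)} f(m^{[1](2)})`. -/
theorem coact_evalRight (M : Comod C) (f : C →ₗ[A] A) (m : M) :
    M.coact (BTensor.evalRight f (M.coact m)) =
      BTensor.map LinearMap.id ((evalRightL f).comp C.comul) (M.coact m) := by
  have key₁ : ∀ z : BTensor A (BTensor A M C) C,
      BTensor.map LinearMap.id (evalRightL f) (BTensor.assoc M C C z) = BTensor.evalRight f z := by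
    intro z
    induction z using BTensor.induction_left with
    | tmul m c d => rfl
    | add x y hx hy => simp only [map_add, hx, hy]
  have key₂ : ∀ z : BTensor A M C, M.coact (BTensor.evalRight f z) =
      BTensor.evalRight f (BTensor.map M.coact LinearMap.id z) := BTensor.eq_of_tmul _ _
    (fun x y => by rw [map_add, map_add]) (fun x y => by rw [map_add, map_add])
    (fun m c => map_smul M.coact _ _)
  rw [key₂, ← key₁, M.coassoc, BTensor.map_map, LinearMap.id_comp]

/-- The abelian group underlying a right `C`-comodule `M`, regarded as a right `L`-module via
`m l = m^{[0]} ε_C(m^{[1]} l)`. -/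
def Res (_E : RightExtension C D) (M : Comod C) : Type u := M

instance (E : RightExtension C D) (M : Comod C) : AddCommGroup (E.Res M) := inferInstanceAs (AddCommGroup M)

/-- The left `End^C(M)`-module structure of `M`. -/
instance (E : RightExtension C D) (M : Comod C) : Module (End M) (E.Res M) :=
  inferInstanceAs (Module (End M) M)

theorem coact_res (E : RightExtension C D) (M : Comod C) (l : Lᵐᵒᵖ) (m : M) :
    M.coact (BTensor.evalRight (counitSMul C l) (M.coact m)) = l • M.coact m := by
  have key : ∀ z : BTensor A M C, BTensor.map LinearMap.id
      ((evalRightL (counitSMul C l)).comp C.comul) z = l • z := BTensor.eq_of_tmul _ _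
    (fun x y => map_add _ _ _) (fun x y => smul_add _ _ _)
    (fun m c => congrArg (BTensor.tmul A m) (E.evalRight_comul l c))
  rw [coact_evalRight, key]

instance resModule (E : RightExtension C D) (M : Comod C) : Module Lᵐᵒᵖ (E.Res M) where
  smul l m := BTensor.evalRight (M := M) (counitSMul C l) (M.coact m)
  one_smul m := by
    have h : counitSMul C (1 : Lᵐᵒᵖ) = C.counit :=
      LinearMap.ext fun c => congrArg C.counit (one_smul Lᵐᵒᵖ c)
    have h' : BTensor.evalRight (M := M) (counitSMul C (1 : Lᵐᵒᵖ)) (M.coact m) = m := by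
      rw [h]
      exact M.evalRight_counit m
    exact h'
  mul_smul l l' m := by
    refine Eq.trans ?_ (congrArg (BTensor.evalRight (counitSMul C l)) (E.coact_res M l' m)).symm
    exact BTensor.eq_of_tmul (fun z => BTensor.evalRight (counitSMul C (l * l')) z)
      (fun z => BTensor.evalRight (counitSMul C l) (l' • z))
      (fun x y => map_add _ _ _) (fun x y => by rw [smul_add, map_add])
      (fun m c => congrArg (fun x => op (C.counit x) • m) (mul_smul l l' c)) (M.coact m)
  smul_zero l := by
    have h : BTensor.evalRight (M := M) (counitSMul C l) (M.coact 0) = 0 := by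
      rw [map_zero, map_zero]
    exact h
  smul_add l (m m' : M) := by
    have h : BTensor.evalRight (M := M) (counitSMul C l) (M.coact (m + m')) =
        BTensor.evalRight (counitSMul C l) (M.coact m) +
          BTensor.evalRight (counitSMul C l) (M.coact m') := by
      rw [map_add, map_add]
    exact h
  add_smul l l' m := BTensor.eq_of_tmul (fun z => BTensor.evalRight (counitSMul C (l + l')) z)
      (fun z => BTensor.evalRight (counitSMul C l) z + BTensor.evalRight (counitSMul C l') z)
      (fun x y => map_add _ _ _) (fun x y => by rw [map_add, map_add]; abel)
      (fun m c => by
        have h : C.counit ((l + l') • c) = C.counit (l • c) + C.counit (l' • c) := by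
          rw [add_smul, map_add]
        refine (congrArg (fun a => op a • m) h).trans ?_
        exact add_smul (op (C.counit (l • c))) (op (C.counit (l' • c))) m) (M.coact m)
  zero_smul m := BTensor.eq_of_tmul (fun z => BTensor.evalRight (counitSMul C (0 : Lᵐᵒᵖ)) z)
      (fun z => (0 : M)) (fun x y => map_add _ _ _) (fun x y => (add_zero 0).symm)
      (fun m c => by
        have h : C.counit ((0 : Lᵐᵒᵖ) • c) = 0 := by rw [zero_smul, map_zero]
        refine (congrArg (fun a => op a • m) h).trans ?_
        exact zero_smul Aᵐᵒᵖ m) (M.coact m)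

theorem res_smul_def (E : RightExtension C D) (M : Comod C) (l : Lᵐᵒᵖ) (m : E.Res M) :
    l • m = BTensor.evalRight (M := M) (counitSMul C l) (M.coact m) := rfl

/-- The coaction `ϱ : M → M ⊗_A C` as a right `L`-linear map. -/
def rho (E : RightExtension C D) (M : Comod C) : E.Res M →ₗ[Lᵐᵒᵖ] BTensor A M C where
  toFun m := M.coact m
  map_add' := map_add M.coact
  map_smul' l m := E.coact_res M l m

/-- `ϱ ⊗_A C : M ⊗_A C → (M ⊗_A C) ⊗_A C` as a right `L`-linear map. -/
def rhoC (_E : RightExtension C D) (M : Comod C) :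
    BTensor A M C →ₗ[Lᵐᵒᵖ] BTensor A (BTensor A M C) C :=
  BTensor.mapR L C M.coact

/-- `M ⊗_A Δ_C : M ⊗_A C → (M ⊗_A C) ⊗_A C` as a right `L`-linear map. -/
def comulM (E : RightExtension C D) (M : Comod C) : BTensor A M C →ₗ[Lᵐᵒᵖ] BTensor A (BTensor A M C) C where
  toFun z := (BTensor.assoc M C C).symm (BTensor.map LinearMap.id C.comul z)
  map_add' x y := by rw [map_add, map_add]
  map_smul' l := BTensor.eq_of_tmul _ _
    (fun x y => by rw [smul_add, map_add, map_add])
    (fun x y => by rw [map_add, map_add, smul_add])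
    (fun m c => by
      have key : ∀ z : BTensor A C C, (BTensor.assoc M C C).symm (BTensor.tmul A m (l • z)) =
          l • (BTensor.assoc M C C).symm (BTensor.tmul A m z) := BTensor.eq_of_tmul _ _
        (fun x y => by rw [smul_add, BTensor.tmul_add, map_add])
        (fun x y => by rw [BTensor.tmul_add, map_add, smul_add]) (fun c d => rfl)
      refine Eq.trans ?_ (key (C.comul c))
      exact congrArg (fun z => (BTensor.assoc M C C).symm (BTensor.tmul A m z))
        (E.comul_op_smul l.unop c))

/-- The right extension `D` of `C` is pure: for every right `C`-comodule `M`, the equaliser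
`M → M ⊗_A C ⇉ M ⊗_A C ⊗_A C` of right `L`-modules is preserved by `- ⊗_L (D ⊗_L D)`. -/
def IsPure (E : RightExtension C D) : Prop :=
  ∀ M : Comod C, IsEqualizer
    (BTensor.map (E.rho M) (LinearMap.id : BTensor L D D →ₗ[L] BTensor L D D))
    (BTensor.map (E.rhoC M) (LinearMap.id : BTensor L D D →ₗ[L] BTensor L D D))
    (BTensor.map (E.comulM M) (LinearMap.id : BTensor L D D →ₗ[L] BTensor L D D))

/-- A `D ⊗_L D`-pure equaliser is `D`-pure, since `D` is a retract of `D ⊗_L D`. -/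
theorem IsPure.isEqualizer {E : RightExtension C D} (hE : E.IsPure) (M : Comod C) : IsEqualizer
    (BTensor.map (E.rho M) (LinearMap.id : D →ₗ[L] D))
    (BTensor.map (E.rhoC M) (LinearMap.id : D →ₗ[L] D))
    (BTensor.map (E.comulM M) (LinearMap.id : D →ₗ[L] D)) := by
  let r : BTensor L D D →ₗ[L] D := evalRightL D.counit
  have hr : r.comp D.comul = LinearMap.id := LinearMap.ext D.evalRight_counit
  obtain ⟨h₁, h₂⟩ := hE M
  refine ⟨fun t t' h => ?_, fun y => ⟨fun h => ?_, ?_⟩⟩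
  · have h3 : BTensor.map LinearMap.id D.comul t = BTensor.map LinearMap.id D.comul t' := by
      apply h₁
      have := congrArg (BTensor.map LinearMap.id D.comul) h
      simpa only [BTensor.map_map, LinearMap.id_comp, LinearMap.comp_id] using this
    have := congrArg (BTensor.map LinearMap.id r) h3
    simpa only [BTensor.map_map, LinearMap.id_comp, hr, BTensor.map_id] using this
  · have h3 := congrArg (BTensor.map LinearMap.id D.comul) h
    have h4 : BTensor.map (E.rhoC M) LinearMap.id (BTensor.map LinearMap.id D.comul y) =
        BTensor.map (E.comulM M) LinearMap.id (BTensor.map LinearMap.id D.comul y) := by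
      simpa only [BTensor.map_map, LinearMap.id_comp, LinearMap.comp_id] using h3
    obtain ⟨w, hw⟩ := (h₂ _).1 h4
    refine ⟨BTensor.map LinearMap.id r w, ?_⟩
    have := congrArg (BTensor.map LinearMap.id r) hw
    simpa only [BTensor.map_map, LinearMap.id_comp, LinearMap.comp_id, hr, BTensor.map_id]
      using this
  · rintro ⟨t, rfl⟩
    have h3 : (E.rhoC M).comp (E.rho M) = (E.comulM M).comp (E.rho M) := by
      refine LinearMap.ext fun m => ?_
      exact (AddEquiv.symm_apply_eq _).2 (M.coassoc m).symm |>.symm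
    rw [BTensor.map_map, BTensor.map_map, h3]

/-- The map `M → (M ⊗_A C) ⊗_L D`, `m ↦ (m^{[0]} ⊗ m^{[1]}_{[0]}) ⊗ m^{[1]}_{[1]}`. -/
def preCoact (E : RightExtension C D) (M : Comod C) : M →+ BTensor L (BTensor A M C) D where
  toFun m := (BTensor.assoc M C D).symm (BTensor.map LinearMap.id E.coact (M.coact m))
  map_zero' := by rw [map_zero, map_zero, map_zero]
  map_add' m m' := by rw [map_add, map_add, map_add]

theorem preCoact_apply (E : RightExtension C D) (M : Comod C) (m : M) : E.preCoact M m =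
    (BTensor.assoc M C D).symm (BTensor.map LinearMap.id E.coact (M.coact m)) := rfl

theorem rhoC_preCoact (E : RightExtension C D) (M : Comod C) (m : M) :
    BTensor.map (E.rhoC M) LinearMap.id (E.preCoact M m) =
      BTensor.map (E.comulM M) LinearMap.id (E.preCoact M m) := by
  -- both sides, re-associated, equal the image of `(ϱ ⊗ C)ϱ(m)` under `(M ⊗ C) ⊗ τ`
  apply (BTensor.assoc (BTensor A M C) C D).injective
  have h₁ : BTensor.assoc (BTensor A M C) C D
      (BTensor.map (E.rhoC M) LinearMap.id (E.preCoact M m)) =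
      BTensor.map LinearMap.id E.coact (BTensor.map M.coact LinearMap.id (M.coact m)) := by
    refine (BTensor.assoc_map M.coact LinearMap.id _).trans ?_
    rw [preCoact_apply, AddEquiv.apply_symm_apply, BTensor.mapL_id, BTensor.map_map,
      BTensor.map_map, LinearMap.id_comp, LinearMap.id_comp, LinearMap.comp_id, LinearMap.comp_id]
  have h₂ : ∀ z : BTensor A M C, BTensor.assoc (BTensor A M C) C D
      (BTensor.map (E.comulM M) LinearMap.id
        ((BTensor.assoc M C D).symm (BTensor.map LinearMap.id E.coact z))) =
      BTensor.map LinearMap.id E.coact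
        ((BTensor.assoc M C C).symm (BTensor.map LinearMap.id C.comul z)) := by
    refine BTensor.eq_of_tmul _ _ (fun x y => by simp only [map_add])
      (fun x y => by simp only [map_add]) (fun m c => ?_)
    have k₁ : ∀ y : BTensor L C D, BTensor.assoc (BTensor A M C) C D
        (BTensor.map (E.comulM M) LinearMap.id ((BTensor.assoc M C D).symm (BTensor.tmul A m y))) =
        (BTensor.assoc M C (BTensor L C D)).symm (BTensor.tmul A m
          (BTensor.assoc C C D (BTensor.map E.comulL LinearMap.id y))) := by
      refine BTensor.eq_of_tmul _ _ (fun x y => by simp only [map_add, BTensor.tmul_add])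
        (fun x y => by simp only [map_add, BTensor.tmul_add]) (fun c d => ?_)
      have k₂ : ∀ z : BTensor A C C, BTensor.assoc (BTensor A M C) C D
          (BTensor.tmul L ((BTensor.assoc M C C).symm (BTensor.tmul A m z)) d) =
          (BTensor.assoc M C (BTensor L C D)).symm (BTensor.tmul A m
            (BTensor.assoc C C D (BTensor.tmul L z d))) :=
        BTensor.eq_of_tmul _ _
          (fun x y => by simp only [map_add, BTensor.tmul_add, BTensor.add_tmul])
          (fun x y => by simp only [map_add, BTensor.tmul_add, BTensor.add_tmul])
          (fun _ _ => rfl)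
      exact k₂ (C.comul c)
    have k₃ : ∀ z : BTensor A C C, (BTensor.assoc M C (BTensor L C D)).symm (BTensor.tmul A m
        (BTensor.map LinearMap.id E.coact z)) =
        BTensor.map LinearMap.id E.coact ((BTensor.assoc M C C).symm (BTensor.tmul A m z)) :=
      BTensor.eq_of_tmul _ _ (fun x y => by simp only [map_add, BTensor.tmul_add])
        (fun x y => by simp only [map_add, BTensor.tmul_add]) (fun _ _ => rfl)
    refine (k₁ (E.coact c)).trans ((congrArg (fun z => (BTensor.assoc M C (BTensor L C D)).symm
      (BTensor.tmul A m z)) (E.comul_coact c)).trans (k₃ (C.comul c)))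
  rw [h₁, preCoact_apply, h₂, ← M.coassoc, AddEquiv.symm_apply_apply]

variable {E : RightExtension C D}

theorem IsPure.exists_tau (hE : E.IsPure) (M : Comod C) (m : M) :
    ∃ t : BTensor L (E.Res M) D, BTensor.map (E.rho M) LinearMap.id t = E.preCoact M m :=
  ((hE.isEqualizer M).2 _).1 (E.rhoC_preCoact M m)

/-- The right `D`-coaction `τ_M : M → M ⊗_L D` on a right `C`-comodule `M`: by purity, `M ⊗_L D` is
identified through `ϱ ⊗_L D` with the cotensor product of `M` and `C ⊗_L D`, and `τ_M(m)` is the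
element corresponding to `m^{[0]} ⊗ m^{[1]}_{[0]} ⊗ m^{[1]}_{[1]}`; informally,
`τ_M(m) = m^{[0]} ε_C(m^{[1]}_{[0]}) ⊗ m^{[1]}_{[1]}`. -/
def tau (hE : E.IsPure) (M : Comod C) : E.Res M →+ BTensor L (E.Res M) D where
  toFun m := (hE.exists_tau M m).choose
  map_zero' := (hE.isEqualizer M).1 <|
    (hE.exists_tau M 0).choose_spec.trans <| (map_zero _).trans (map_zero _).symm
  map_add' m m' := (hE.isEqualizer M).1 <|
    (hE.exists_tau M (m + m')).choose_spec.trans <| (map_add _ m m').trans <| Eq.symm <|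
      (map_add _ _ _).trans <|
        congrArg₂ _ (hE.exists_tau M m).choose_spec (hE.exists_tau M m').choose_spec

/-- The coaction `ϱ` is right `D`-colinear. -/
theorem map_rho_tau (hE : E.IsPure) (M : Comod C) (m : E.Res M) :
    BTensor.map (E.rho M) LinearMap.id (tau hE M m) = E.preCoact M m :=
  (hE.exists_tau M m).choose_spec

end RightExtension

/-! ### Bicomodules and the Morita context -/

/-- An `L`-`C` bicomodule: a right `C`-comodule that is a left `L`-module (and an `L`-`A` bimodule)
with a left `L`-linear `C`-coaction. -/
structure Bicomod {A : Type u} [Ring A] (L : Type u) [Ring L] (C : Coring A) extends Comod C where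
  [leftModule : Module L carrier]
  [smulCommClass : SMulCommClass L Aᵐᵒᵖ carrier]
  coact_smul : ∀ (l : L) (x : carrier), coact (l • x) = l • coact x

attribute [instance] Bicomod.leftModule Bicomod.smulCommClass

namespace Bicomod

variable {A L : Type u} [Ring A] [Ring L] {C : Coring A} (S : Bicomod L C)

instance : CoeSort (Bicomod L C) (Type u) := ⟨fun S => S.carrier⟩

/-- The algebra `T = End^C(S)`, with composition as multiplication. -/
abbrev T : Type u := End S.toComod

/-- Left multiplication by `l` as a right `A`-linear map. -/
def lmul (l : L) : S →ₗ[Aᵐᵒᵖ] S where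
  toFun x := l • x
  map_add' := smul_add l
  map_smul' a x := smul_comm l a x

/-- The unit map `L → T`, `l ↦ (x ↦ l x)` of the `L`-ring `T`. -/
def unit (l : L) : S.T :=
  Comod.ofLin (M := S.toComod) (N := S.toComod) (S.lmul l) fun x => by
    have h := BTensor.eq_of_tmul (fun z : BTensor A S C => BTensor.map (S.lmul l) LinearMap.id z)
      (fun z => l • z) (fun x y => map_add _ _ _) (fun x y => smul_add _ _ _) (fun x c => rfl)
    exact (h (S.coact x)).trans (S.coact_smul l x).symm

theorem unit_smul (l : L) (x : S) : S.unit l • x = l • x := rfl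

theorem T_ext {s t : S.T} (h : ∀ x : S, s • x = t • x) : s = t := Comod.hom_ext h

theorem unit_one : S.unit 1 = 1 := S.T_ext fun x => one_smul L x

theorem unit_add (l l' : L) : S.unit (l + l') = S.unit l + S.unit l' :=
  S.T_ext fun x => add_smul l l' x

theorem unit_mul (l l' : L) : S.unit (l * l') = S.unit l * S.unit l' :=
  S.T_ext fun x => mul_smul l l' x

/-! #### The convolution algebra `_L Hom_L(D, T)` -/

/-- The `L`-`L` bimodule maps `D → T`, where `T` is an `L`-`L` bimodule through the unit map. -/
def homLL (D : Coring L) : AddSubgroup (D →+ S.T) where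
  carrier := {v | ∀ (l : L) (d : D), v (l • d) = S.unit l * v d ∧ v (op l • d) = v d * S.unit l}
  add_mem' {v w} hv hw l d := by
    simp only [AddMonoidHom.add_apply, (hv l d).1, (hv l d).2, (hw l d).1, (hw l d).2, mul_add,
      add_mul, and_self]
  zero_mem' l d := by simp
  neg_mem' {v} hv l d := by
    simp only [AddMonoidHom.neg_apply, (hv l d).1, (hv l d).2, mul_neg, neg_mul, and_self]

section Conv

variable {S} {D : Coring L}

theorem homLL_ext {v w : S.homLL D} (h : ∀ d, v.1 d = w.1 d) : v = w :=
  Subtype.ext (AddMonoidHom.ext h)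

/-- `d ⊗ d' ↦ v(d) w(d')`. -/
def convAux (v w : S.homLL D) : BTensor L D D →+ S.T :=
  BTensor.lift (fun d d' => v.1 d * w.1 d') (fun d d' e => by rw [map_add, add_mul])
    (fun d e e' => by rw [map_add, mul_add])
    (fun l d e => by rw [(v.2 l d).2, (w.2 l e).1, mul_assoc])

/-- The convolution product `(v w)(d) = v(d_{(1)}) w(d_{(2)})`. -/
instance : Mul (S.homLL D) where
  mul v w := ⟨(convAux v w).comp (D.comul : D →+ BTensor L D D), fun l d => by
    have h₁ := BTensor.eq_of_tmul (fun z => convAux v w (l • z))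
      (fun z => S.unit l * convAux v w z) (fun x y => by rw [smul_add, map_add])
      (fun x y => by rw [map_add, mul_add])
      (fun d e => (congrArg (· * w.1 e) (v.2 l d).1).trans (mul_assoc _ _ _))
    have h₂ := BTensor.eq_of_tmul (fun z => convAux v w (op l • z))
      (fun z => convAux v w z * S.unit l) (fun x y => by rw [smul_add, map_add])
      (fun x y => by rw [map_add, add_mul])
      (fun d e => (congrArg (v.1 d * ·) (w.2 l e).2).trans (mul_assoc _ _ _).symm)
    exact ⟨(congrArg (convAux v w) (map_smul D.comul l d)).trans (h₁ _),
      (congrArg (convAux v w) (D.comul_op_smul l d)).trans (h₂ _)⟩⟩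

/-- The unit `d ↦ ε_D(d) 1_T` of the convolution product. -/
instance : One (S.homLL D) where
  one := ⟨AddMonoidHom.mk' (fun d => S.unit (D.counit d))
      (fun d e => by rw [map_add, unit_add]), fun l d =>
    ⟨by simp only [AddMonoidHom.mk'_apply, map_smul, smul_eq_mul, unit_mul],
      by simp only [AddMonoidHom.mk'_apply, D.counit_op_smul, unit_mul]⟩⟩

theorem homLL_mul_apply (v w : S.homLL D) (d : D) : (v * w).1 d = convAux v w (D.comul d) := rfl

theorem homLL_one_apply (d : D) : (1 : S.homLL D).1 d = S.unit (D.counit d) := rfl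

/-- `d ⊗ (d' ⊗ d'') ↦ u(d) (v(d') w(d''))`. -/
def convAux₃ (u v w : S.homLL D) : BTensor L D (BTensor L D D) →+ S.T :=
  BTensor.lift (fun d z => u.1 d * convAux v w z) (fun d d' e => by rw [map_add, add_mul])
    (fun d e e' => by rw [map_add, mul_add])
    (fun l d z => by
      rw [(u.2 l d).2, mul_assoc]
      refine congrArg (u.1 d * ·) ?_
      exact BTensor.eq_of_tmul (fun z => S.unit l * convAux v w z) (fun z => convAux v w (l • z))
        (fun x y => by rw [map_add, mul_add]) (fun x y => by rw [smul_add, map_add])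
        (fun d e => (mul_assoc _ _ _).symm.trans (congrArg (· * w.1 e) (v.2 l d).1.symm)) z)

theorem homLL_mul_assoc (u v w : S.homLL D) : u * v * w = u * (v * w) := by
  refine homLL_ext fun d => ?_
  have h₁ : ∀ z, convAux (u * v) w z = convAux₃ u v w
      (BTensor.assoc D D D (BTensor.map D.comulR LinearMap.id z)) :=
    BTensor.eq_of_tmul _ _ (fun x y => by rw [map_add])
      (fun x y => by rw [map_add, map_add, map_add]) fun a b =>
        BTensor.eq_of_tmul (fun y => convAux u v y * w.1 b)
          (fun y => convAux₃ u v w (BTensor.assoc D D D (BTensor.tmul L y b)))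
          (fun x y => by rw [map_add, add_mul])
          (fun x y => by rw [BTensor.add_tmul, map_add, map_add])
          (fun x y => mul_assoc _ _ _) (D.comul a)
  have h₂ : ∀ z, convAux u (v * w) z = convAux₃ u v w (BTensor.map LinearMap.id D.comul z) :=
    BTensor.eq_of_tmul _ _ (fun x y => by rw [map_add])
      (fun x y => by rw [map_add, map_add]) fun a b => rfl
  rw [homLL_mul_apply, homLL_mul_apply, h₁, h₂, ← D.coassoc]
  rfl

/-- The algebra `_L Hom_L(D, T)` with the convolution product. -/
instance : Ring (S.homLL D) :=
  { (inferInstance : AddCommGroup (S.homLL D)), (inferInstance : Mul (S.homLL D)),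
    (inferInstance : One (S.homLL D)) with
    mul_assoc := homLL_mul_assoc
    one_mul := fun v => homLL_ext fun d =>
      (BTensor.eq_of_tmul (fun z => convAux 1 v z) (fun z => v.1 (BTensor.evalLeft D.counitR z))
        (fun x y => map_add _ _ _) (fun x y => by rw [map_add, map_add])
        (fun a b => (v.2 (D.counit a) b).1.symm) (D.comul d)).trans
        (congrArg v.1 (D.evalLeft_counit d))
    mul_one := fun v => homLL_ext fun d =>
      (BTensor.eq_of_tmul (fun z => convAux v 1 z) (fun z => v.1 (BTensor.evalRight D.counit z))
        (fun x y => map_add _ _ _) (fun x y => by rw [map_add, map_add])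
        (fun a b => (v.2 (D.counit b) a).2.symm) (D.comul d)).trans
        (congrArg v.1 (D.evalRight_counit d))
    left_distrib := fun u v w => homLL_ext fun d =>
      BTensor.eq_of_tmul (fun z => convAux u (v + w) z) (fun z => convAux u v z + convAux u w z)
        (fun x y => map_add _ _ _) (fun x y => by rw [map_add, map_add]; abel)
        (fun a b => mul_add _ _ _) (D.comul d)
    right_distrib := fun u v w => homLL_ext fun d =>
      BTensor.eq_of_tmul (fun z => convAux (u + v) w z) (fun z => convAux u w z + convAux v w z)
        (fun x y => map_add _ _ _) (fun x y => by rw [map_add, map_add]; abel)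
        (fun a b => add_mul _ _ _) (D.comul d)
    zero_mul := fun v => homLL_ext fun d =>
      BTensor.eq_of_tmul (fun z => convAux 0 v z) (fun z => 0)
        (fun x y => map_add _ _ _) (fun x y => (add_zero 0).symm)
        (fun a b => zero_mul _) (D.comul d)
    mul_zero := fun v => homLL_ext fun d =>
      BTensor.eq_of_tmul (fun z => convAux v 0 z) (fun z => 0)
        (fun x y => map_add _ _ _) (fun x y => (add_zero 0).symm)
        (fun a b => mul_zero _) (D.comul d) }

end Conv

end Bicomod

namespace RightExtension

variable {A L : Type u} [Ring A] [Ring L] {C : Coring A} {D : Coring L}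
  [Module Lᵐᵒᵖ C] [SMulCommClass A Lᵐᵒᵖ C]

/-- The left `L`-module structure of an `L`-`C` bicomodule `S`. -/
instance (E : RightExtension C D) (S : Bicomod L C) : Module L (E.Res S.toComod) :=
  inferInstanceAs (Module L S)

/-- A morphism of right `C`-comodules is right `L`-linear. -/
def resMap (E : RightExtension C D) {M N : Comod C} (f : M ⟶ N) :
    E.Res M →ₗ[Lᵐᵒᵖ] E.Res N where
  toFun m := Comod.lin f m
  map_add' := map_add (Comod.lin f)
  map_smul' l (m : M) := by
    have h := BTensor.eq_of_tmul
      (fun z : BTensor A M C => Comod.lin f (BTensor.evalRight (counitSMul C l) z))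
      (fun z => BTensor.evalRight (counitSMul C l) (BTensor.map (Comod.lin f) LinearMap.id z))
      (fun x y => by rw [map_add, map_add]) (fun x y => by rw [map_add, map_add])
      (fun x c => map_smul (Comod.lin f) _ _) (M.coact m)
    exact h.trans (congrArg (BTensor.evalRight (counitSMul C l)) (Comod.lin_comm f m))

/-- A morphism of right `C`-comodules is right `D`-colinear. -/
theorem tau_resMap {E : RightExtension C D} (hE : E.IsPure) {M N : Comod C} (f : M ⟶ N)
    (m : E.Res M) :
    tau hE N (E.resMap f m) = BTensor.map (E.resMap f) LinearMap.id (tau hE M m) := by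
  apply (hE.isEqualizer N).1
  rw [map_rho_tau, BTensor.map_map]
  have h₁ : (E.rho N).comp (E.resMap f) = (BTensor.mapR L C (Comod.lin f)).comp (E.rho M) :=
    LinearMap.ext fun m => (Comod.lin_comm f m).symm
  have h₂ : ∀ m : M, BTensor.map (BTensor.mapR L C (Comod.lin f)) LinearMap.id (E.preCoact M m) =
      E.preCoact N (Comod.lin f m) := fun m => by
    apply (BTensor.assoc N C D).injective
    rw [BTensor.assoc_map, preCoact_apply, preCoact_apply, AddEquiv.apply_symm_apply,
      AddEquiv.apply_symm_apply, BTensor.mapL_id, ← Comod.lin_comm, BTensor.map_map,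
      BTensor.map_map, LinearMap.id_comp, LinearMap.id_comp, LinearMap.comp_id, LinearMap.comp_id]
  rw [h₁, LinearMap.comp_id, ← LinearMap.comp_id (LinearMap.id : D →ₗ[L] D), ← BTensor.map_map,
    map_rho_tau]
  exact (h₂ m).symm

theorem resMap_apply (E : RightExtension C D) {M : Comod C} (t : End M) (m : E.Res M) :
    E.resMap (t : M ⟶ M) m = t • m := rfl

theorem smul_op_smul (E : RightExtension C D) {M : Comod C} (t : End M) (l : Lᵐᵒᵖ) (m : E.Res M) :
    t • l • m = l • t • m := map_smul (E.resMap (t : M ⟶ M)) l m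

end RightExtension

namespace Bicomod

open RightExtension

variable {A L : Type u} [Ring A] [Ring L] {C : Coring A} {D : Coring L}
  [Module Lᵐᵒᵖ C] [SMulCommClass A Lᵐᵒᵖ C] {E : RightExtension C D} (hE : E.IsPure)
  (S : Bicomod L C)

/-! #### The left module `_L Hom^D(D, S)` -/

/-- The left `L`-linear right `D`-colinear maps `D → S`. -/
def homLD : AddSubgroup (D →ₗ[Lᵐᵒᵖ] E.Res S.toComod) where
  carrier := {p | (∀ (l : L) (d : D), p (l • d) = l • p d) ∧
    ∀ d : D, tau hE S.toComod (p d) = BTensor.map p LinearMap.id (D.comul d)}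
  add_mem' {p p'} hp hp' :=
    ⟨fun l d => by
      rw [LinearMap.add_apply, LinearMap.add_apply, hp.1, hp'.1, smul_add],
      fun d => by
        rw [LinearMap.add_apply, map_add, hp.2 d, hp'.2 d, BTensor.map_add_left]⟩
  zero_mem' := ⟨fun l d => (smul_zero l).symm,
    fun d => by rw [LinearMap.zero_apply, map_zero, BTensor.map_zero_left]⟩
  neg_mem' {p} hp :=
    ⟨fun l d => by rw [LinearMap.neg_apply, LinearMap.neg_apply, hp.1, smul_neg],
      fun d => by rw [LinearMap.neg_apply, map_neg, hp.2 d, BTensor.map_neg_left]⟩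

variable {hE S}

theorem homLD_ext {p p' : homLD hE S} (h : ∀ d, p.1 d = p'.1 d) : p = p' :=
  Subtype.ext (LinearMap.ext h)

theorem unit_smul_res (l : L) (x : E.Res S.toComod) : S.unit l • x = l • x := rfl

/-- `d ⊗ d' ↦ v(d)(p(d'))`. -/
def actAux (v : S.homLL D) (p : homLD hE S) : BTensor L D D →+ E.Res S.toComod :=
  BTensor.lift (fun d d' => v.1 d • p.1 d')
    (fun d d' e => by rw [map_add, add_smul])
    (fun d e e' => by rw [map_add, smul_add])
    (fun l d e => by rw [(v.2 l d).2, mul_smul, p.2.1, unit_smul_res])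

theorem actAux_tmul (v : S.homLL D) (p : homLD hE S) (d e : D) :
    actAux v p (BTensor.tmul L d e) = v.1 d • p.1 e := rfl

theorem actAux_op_smul (v : S.homLL D) (p : homLD hE S) (l : Lᵐᵒᵖ) (z : BTensor L D D) :
    actAux v p (l • z) = l • actAux v p z :=
  BTensor.eq_of_tmul (fun z => actAux v p (l • z)) (fun z => l • actAux v p z)
    (fun x y => by rw [smul_add, map_add]) (fun x y => by rw [map_add, smul_add])
    (fun a b => by rw [BTensor.smul_right, actAux_tmul, actAux_tmul, map_smul, smul_op_smul]) z

theorem actAux_smul (v : S.homLL D) (p : homLD hE S) (l : L) (z : BTensor L D D) :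
    actAux v p (l • z) = l • actAux v p z :=
  BTensor.eq_of_tmul (fun z => actAux v p (l • z)) (fun z => l • actAux v p z)
    (fun x y => by rw [smul_add, map_add]) (fun x y => by rw [map_add, smul_add])
    (fun a b => by
      rw [BTensor.smul_left, actAux_tmul, actAux_tmul, (v.2 l a).1, mul_smul, unit_smul_res]) z

/-- `d ↦ v(d_{(1)})(p(d_{(2)}))`. -/
def actLin (v : S.homLL D) (p : homLD hE S) : D →ₗ[Lᵐᵒᵖ] E.Res S.toComod where
  toFun d := actAux v p (D.comul d)
  map_add' d e := by rw [map_add, map_add]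
  map_smul' l d := (congrArg (actAux v p) (D.comul_op_smul l.unop d)).trans
    (actAux_op_smul v p l _)

theorem actLin_apply (v : S.homLL D) (p : homLD hE S) (d : D) :
    actLin v p d = actAux v p (D.comul d) := rfl

/-- `d ⊗ z ↦ (v(d) p ⊗ D)(z)`. -/
def actAux₃ (v : S.homLL D) (p : homLD hE S) :
    BTensor L D (BTensor L D D) →+ BTensor L (E.Res S.toComod) D :=
  BTensor.lift
    (fun d z => BTensor.map ((E.resMap (v.1 d : S.toComod ⟶ S.toComod)).comp p.1) LinearMap.id z)
    (fun d d' z => by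
      rw [← BTensor.map_add_left]
      refine congrArg (fun f => BTensor.map f LinearMap.id z) (LinearMap.ext fun e => ?_)
      exact (congrArg (fun t : S.T => t • p.1 e) (map_add v.1 d d')).trans (add_smul _ _ _))
    (fun d z z' => map_add _ _ _)
    (fun l d z => BTensor.eq_of_tmul
      (fun z => BTensor.map ((E.resMap (v.1 (op l • d) : S.toComod ⟶ S.toComod)).comp p.1)
        LinearMap.id z)
      (fun z => BTensor.map ((E.resMap (v.1 d : S.toComod ⟶ S.toComod)).comp p.1)
        LinearMap.id (l • z))
      (fun x y => map_add _ _ _) (fun x y => by rw [smul_add, map_add])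
      (fun a b => congrArg (fun x => BTensor.tmul L x b) <| by
        refine (congrArg (fun t : S.T => t • p.1 a) (v.2 l d).2).trans ?_
        rw [mul_smul, unit_smul_res, ← p.2.1]
        rfl) z)

theorem actLin_mem (v : S.homLL D) (p : homLD hE S) : actLin v p ∈ homLD hE S := by
  refine ⟨fun l d => ?_, fun d => ?_⟩
  · rw [actLin_apply, map_smul, actAux_smul, actLin_apply]
  · have h₁ : ∀ z, tau hE S.toComod (actAux v p z) =
        actAux₃ v p (BTensor.map LinearMap.id D.comul z) :=
      BTensor.eq_of_tmul _ _ (fun x y => by rw [map_add, map_add])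
        (fun x y => by rw [map_add, map_add]) fun a b => by
          rw [actAux_tmul, ← resMap_apply, tau_resMap, p.2.2, BTensor.map_map]
          rfl
    have h₂ : ∀ z, BTensor.map (actLin v p) LinearMap.id z =
        actAux₃ v p (BTensor.assoc D D D (BTensor.map D.comulR LinearMap.id z)) :=
      BTensor.eq_of_tmul _ _ (fun x y => map_add _ x y)
        (fun x y => by rw [map_add, map_add, map_add]) fun a b =>
          BTensor.eq_of_tmul
            (fun y => BTensor.tmul L (actAux v p y) b)
            (fun y => actAux₃ v p (BTensor.assoc D D D (BTensor.tmul L y b)))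
            (fun x y => by rw [map_add, BTensor.add_tmul])
            (fun x y => by rw [BTensor.add_tmul, map_add]; exact map_add _ _ _)
            (fun x y => rfl) (D.comul a)
    rw [h₂, actLin_apply, h₁, ← D.coassoc]
    rfl

/-- `d ⊗ (d' ⊗ d'') ↦ v(d) (w(d')(p(d'')))`. -/
def actAuxMul (v w : S.homLL D) (p : homLD hE S) :
    BTensor L D (BTensor L D D) →+ E.Res S.toComod :=
  BTensor.lift (fun d z => v.1 d • actAux w p z) (fun d e z => by rw [map_add, add_smul])
    (fun d z z' => by rw [map_add, smul_add])
    (fun l d z => by rw [(v.2 l d).2, mul_smul, actAux_smul, unit_smul_res])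

/-- `_L Hom^D(D, S)` is a left `_L Hom_L(D, T)`-module: `(v p)(d) = v(d_{(1)})(p(d_{(2)}))`. -/
instance homLDModule : Module (S.homLL D) (homLD hE S) where
  smul v p := ⟨actLin v p, actLin_mem v p⟩
  one_smul p := homLD_ext fun d =>
    (BTensor.eq_of_tmul (fun z => actAux 1 p z) (fun z => p.1 (BTensor.evalLeft D.counitR z))
      (fun x y => map_add _ _ _) (fun x y => by simp only [map_add])
      (fun a b => (p.2.1 (D.counit a) b).symm) (D.comul d)).trans
      (congrArg p.1 (D.evalLeft_counit d))
  mul_smul v w p := homLD_ext fun d => by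
    have h₁ : ∀ z, actAux (v * w) p z =
        actAuxMul v w p (BTensor.assoc D D D (BTensor.map D.comulR LinearMap.id z)) :=
      BTensor.eq_of_tmul _ _ (fun x y => map_add _ _ _)
        (fun x y => by simp only [map_add]) fun a b =>
          BTensor.eq_of_tmul (fun y => convAux v w y • p.1 b)
            (fun y => actAuxMul v w p (BTensor.assoc D D D (BTensor.tmul L y b)))
            (fun x y => by rw [map_add, add_smul])
            (fun x y => by simp only [BTensor.add_tmul, map_add])
            (fun x y => mul_smul _ _ _) (D.comul a)
    have h₂ : ∀ z, actAux v ⟨actLin w p, actLin_mem w p⟩ z =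
        actAuxMul v w p (BTensor.map LinearMap.id D.comul z) :=
      BTensor.eq_of_tmul _ _ (fun x y => map_add _ _ _)
        (fun x y => by simp only [map_add]) fun a b => rfl
    exact (h₁ _).trans ((congrArg (actAuxMul v w p) (D.coassoc d)).trans (h₂ _).symm)
  smul_zero v := homLD_ext fun d =>
    BTensor.eq_of_tmul (fun z => actAux v (0 : homLD hE S) z) (fun z => 0)
      (fun x y => map_add _ _ _) (fun x y => (add_zero 0).symm)
      (fun a b => smul_zero (v.1 a)) (D.comul d)
  smul_add v p p' := homLD_ext fun d =>
    BTensor.eq_of_tmul (fun z => actAux v (p + p') z) (fun z => actAux v p z + actAux v p' z)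
      (fun x y => map_add _ _ _) (fun x y => by rw [map_add, map_add]; abel)
      (fun a b => smul_add (v.1 a) (p.1 b) (p'.1 b)) (D.comul d)
  add_smul v w p := homLD_ext fun d =>
    BTensor.eq_of_tmul (fun z => actAux (v + w) p z) (fun z => actAux v p z + actAux w p z)
      (fun x y => map_add _ _ _) (fun x y => by rw [map_add, map_add]; abel)
      (fun a b => add_smul (v.1 a) (w.1 a) (p.1 b)) (D.comul d)
  zero_smul p := homLD_ext fun d =>
    BTensor.eq_of_tmul (fun z => actAux 0 p z) (fun z => 0)
      (fun x y => map_add _ _ _) (fun x y => (add_zero 0).symm)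
      (fun a b => zero_smul S.T (p.1 b)) (D.comul d)

theorem homLD_smul_apply (v : S.homLL D) (p : homLD hE S) (d : D) :
    (v • p).1 d = actAux v p (D.comul d) := rfl

end Bicomod

namespace Bicomod

open RightExtension

section Qt

variable {A L : Type u} [Ring A] [Ring L] {C : Coring A} [Module Lᵐᵒᵖ C] [SMulCommClass A Lᵐᵒᵖ C]
  (S : Bicomod L C)

/-! #### The right module `Q̃` -/

/-- The left `A`-linear form `c ↦ q(c)(x)` on `C`. -/
def evalAt {S : Bicomod L C} (q : C →ₗ[A] (S →ₗ[Aᵐᵒᵖ] A)) (x : S) : C →ₗ[A] A where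
  toFun c := q c x
  map_add' c c' := by rw [map_add, LinearMap.add_apply]
  map_smul' a c := by rw [map_smul]; rfl

theorem evalRight_add {f g : C →ₗ[A] A} (z : BTensor A C C) :
    BTensor.evalRight (f + g) z = BTensor.evalRight f z + BTensor.evalRight g z :=
  BTensor.eq_of_tmul _ (fun z => BTensor.evalRight f z + BTensor.evalRight g z)
    (fun x y => map_add _ _ _) (fun x y => by rw [map_add, map_add]; abel)
    (fun m n => (congrArg (fun a => op a • m) (LinearMap.add_apply f g n)).trans
      (add_smul (op (f n)) (op (g n)) m)) z

theorem evalLeft_add {M : Type*} [AddCommGroup M] [Module Aᵐᵒᵖ M] {N : Type*} [AddCommGroup N]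
    [Module A N] (f g : M →ₗ[Aᵐᵒᵖ] A) (z : BTensor A M N) :
    BTensor.evalLeft (f + g) z = BTensor.evalLeft f z + BTensor.evalLeft g z :=
  BTensor.eq_of_tmul _ (fun z => BTensor.evalLeft f z + BTensor.evalLeft g z)
    (fun x y => map_add _ _ _) (fun x y => by rw [map_add, map_add]; abel)
    (fun m n => by simp only [BTensor.evalLeft_tmul, LinearMap.add_apply, add_smul]) z

/-- The `A`-`L` bimodule maps `q : C → S^* = Hom_A(S, A)` such that
`c^{(1)} q(c^{(2)})(x) = q(c)(x^{[0]}) x^{[1]}` for all `c` in `C` and `x` in `S`. -/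
def Qt : AddSubgroup (C →ₗ[A] (S →ₗ[Aᵐᵒᵖ] A)) where
  carrier := {q | (∀ (l : L) (c : C) (x : S), q (op l • c) x = q c (l • x)) ∧
    ∀ (c : C) (x : S),
      BTensor.evalRight (evalAt q x) (C.comul c) = BTensor.evalLeft (q c) (S.coact x)}
  add_mem' {q q'} hq hq' :=
    ⟨fun l c x => by simp only [LinearMap.add_apply, hq.1, hq'.1], fun c x => by
      have h : evalAt (q + q') x = evalAt q x + evalAt q' x := LinearMap.ext fun c => rfl
      rw [h, evalRight_add, hq.2, hq'.2, LinearMap.add_apply, evalLeft_add]⟩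
  zero_mem' := ⟨fun l c x => rfl, fun c x =>
    (BTensor.eq_of_tmul (fun z => BTensor.evalRight (evalAt (0 : C →ₗ[A] (S →ₗ[Aᵐᵒᵖ] A)) x) z)
      (fun z => 0) (fun x y => map_add _ _ _) (fun x y => (add_zero 0).symm)
      (fun c c' => zero_smul Aᵐᵒᵖ c) (C.comul c)).trans
    (BTensor.eq_of_tmul (fun z => BTensor.evalLeft (0 : S →ₗ[Aᵐᵒᵖ] A) z)
      (fun z => 0) (fun x y => map_add _ _ _) (fun x y => (add_zero 0).symm)
      (fun x c' => zero_smul A c') (S.coact x)).symm⟩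
  neg_mem' {q} hq :=
    ⟨fun l c x => by simp only [LinearMap.neg_apply, hq.1], fun c x => by
      have h₁ := BTensor.eq_of_tmul (fun z => BTensor.evalRight (evalAt (-q) x) z)
        (fun z => -BTensor.evalRight (evalAt q x) z) (fun x y => map_add _ _ _)
        (fun x y => by rw [map_add, neg_add])
        (fun c c' => neg_smul (op (q c' x)) c) (C.comul c)
      have h₂ := BTensor.eq_of_tmul (fun z : BTensor A S C => BTensor.evalLeft (-(q c)) z)
        (fun z => -BTensor.evalLeft (q c) z) (fun x y => map_add _ _ _)
        (fun x y => by rw [map_add, neg_add])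
        (fun x c' => neg_smul (q c x) c') (S.coact x)
      exact h₁.trans ((congrArg Neg.neg (hq.2 c x)).trans h₂.symm)⟩

end Qt

variable {A L : Type u} [Ring A] [Ring L] {C : Coring A} {D : Coring L}
  [Module Lᵐᵒᵖ C] [SMulCommClass A Lᵐᵒᵖ C] (E : RightExtension C D) {hE : E.IsPure}
  {S : Bicomod L C}

/-- `c ⊗ d ↦ q(c) ∘ v(d)`. -/
def actQAux (q : S.Qt) (v : S.homLL D) : BTensor L C D →ₗ[A] (S →ₗ[Aᵐᵒᵖ] A) where
  toFun := BTensor.lift (fun c d => op (v.1 d) • q.1 c)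
    (fun c c' d => by rw [map_add, smul_add])
    (fun c d d' => by rw [map_add, MulOpposite.op_add, add_smul])
    (fun l c d => by
      rw [(v.2 l d).1, op_mul, mul_smul]
      refine congrArg (fun f => op (v.1 d) • f) (LinearMap.ext fun x => ?_)
      exact q.2.1 l c x)
  map_add' := map_add _
  map_smul' a := BTensor.eq_of_tmul _ _ (fun x y => by rw [smul_add, map_add])
    (fun x y => by rw [map_add, smul_add])
    (fun c d => by
      rw [BTensor.smul_left, BTensor.lift_tmul, BTensor.lift_tmul, map_smul]
      rfl)

theorem actQAux_tmul (q : S.Qt) (v : S.homLL D) (c : C) (d : D) :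
    actQAux q v (BTensor.tmul L c d) = op (v.1 d) • q.1 c := rfl

/-- `c ↦ q(c_{[0]}) ∘ v(c_{[1]})`. -/
def actQ (q : S.Qt) (v : S.homLL D) : C →ₗ[A] (S →ₗ[Aᵐᵒᵖ] A) := (actQAux q v).comp E.coact

theorem actQ_apply (q : S.Qt) (v : S.homLL D) (c : C) :
    actQ E q v c = actQAux q v (E.coact c) := rfl

/-- `z ↦ f(z)(x)`, for a left `A`-linear map `f` with values in `S^*`. -/
def applyAt {M : Type*} [AddCommGroup M] [Module A M] (f : M →ₗ[A] (S →ₗ[Aᵐᵒᵖ] A)) (x : S) :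
    M →ₗ[A] A where
  toFun z := f z x
  map_add' c c' := by rw [map_add, LinearMap.add_apply]
  map_smul' a c := by rw [map_smul]; rfl

theorem actQ_mem (q : S.Qt) (v : S.homLL D) : actQ E q v ∈ S.Qt := by
  refine ⟨fun l c x => ?_, fun c x => ?_⟩
  · refine (congrArg (fun z => actQAux q v z x) (E.coact_op_smul l c)).trans ?_
    exact BTensor.eq_of_tmul (fun z => actQAux q v (op l • z) x)
      (fun z => actQAux q v z (l • x))
      (fun y z => by rw [smul_add, map_add, LinearMap.add_apply])
      (fun y z => by rw [map_add, LinearMap.add_apply])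
      (fun c d => congrArg (fun t : S.T => q.1 c (t • x)) (v.2 l d).2) (E.coact c)
  · have h₁ : ∀ z : BTensor A C C, BTensor.evalRight (evalAt (actQ E q v) x) z =
        BTensor.evalRight (applyAt (actQAux q v) x) (BTensor.map LinearMap.id E.coact z) :=
      BTensor.eq_of_tmul _ _ (fun y z => map_add _ _ _) (fun y z => by rw [map_add, map_add])
        (fun c c' => rfl)
    have h₂ : ∀ z, BTensor.evalRight (applyAt (actQAux q v) x)
        (BTensor.assoc C C D (BTensor.map E.comulL LinearMap.id z)) =
        BTensor.evalLeft (actQAux q v z) (S.coact x) := by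
      refine BTensor.eq_of_tmul _ _ (fun y z => by simp only [map_add])
        (fun y z => by rw [map_add, evalLeft_add]) (fun c d => ?_)
      have k₁ := BTensor.eq_of_tmul (fun y => BTensor.evalRight (applyAt (actQAux q v) x)
          (BTensor.assoc C C D (BTensor.tmul L y d)))
        (fun y => BTensor.evalRight (evalAt q.1 (v.1 d • x : S)) y)
        (fun y z => by simp only [BTensor.add_tmul, map_add]) (fun y z => map_add _ _ _)
        (fun c c' => rfl) (C.comul c)
      have k₂ := BTensor.eq_of_tmul
        (fun y => BTensor.evalLeft (q.1 c)
          (BTensor.map (Comod.lin (v.1 d : S.toComod ⟶ S.toComod)) LinearMap.id y))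
        (fun y => BTensor.evalLeft (N := C) (actQAux q v (BTensor.tmul L c d)) y)
        (fun y z => by simp only [map_add]) (fun y z => map_add _ _ _)
        (fun x c' => rfl) (S.coact x)
      refine Eq.trans ?_ k₂
      rw [Comod.lin_comm]
      exact k₁.trans (q.2.2 c _)
    rw [h₁, actQ_apply, ← h₂, ← E.comul_coact]
    rfl

/-- `c ⊗ (d ⊗ d') ↦ q(c) ∘ v(d) ∘ w(d')`. -/
def actQMul (q : S.Qt) (v w : S.homLL D) :
    BTensor L C (BTensor L D D) →+ (S →ₗ[Aᵐᵒᵖ] A) :=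
  BTensor.lift (fun c z => op (convAux v w z) • q.1 c)
    (fun c c' z => by rw [map_add, smul_add])
    (fun c z z' => by rw [map_add, MulOpposite.op_add, add_smul])
    (fun l c z => by
      have h := BTensor.eq_of_tmul (fun z => convAux v w (l • z))
        (fun z => S.unit l * convAux v w z) (fun x y => by rw [smul_add, map_add])
        (fun x y => by rw [map_add, mul_add])
        (fun d e => (congrArg (· * w.1 e) (v.2 l d).1).trans (mul_assoc _ _ _)) z
      refine Eq.trans ?_ (congrArg (fun t : S.T => op t • q.1 c) h).symm
      refine Eq.trans ?_ (mul_smul (op (convAux v w z)) (op (S.unit l)) (q.1 c)).symm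
      refine congrArg (fun f => op (convAux v w z) • f) (LinearMap.ext fun x => ?_)
      exact q.2.1 l c x)

/-- `Q̃` is a right `_L Hom_L(D, T)`-module: `(q v)(c) = q(c_{[0]}) ∘ v(c_{[1]})`. -/
abbrev QtModule : Module (S.homLL D)ᵐᵒᵖ S.Qt where
  smul v q := ⟨actQ E q v.unop, actQ_mem E q v.unop⟩
  one_smul q := Subtype.ext <| LinearMap.ext fun c =>
    (BTensor.eq_of_tmul (fun z => actQAux q 1 z) (fun z => q.1 (BTensor.evalRight D.counit z))
      (fun x y => map_add _ _ _) (fun x y => by rw [map_add, map_add])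
      (fun c d => LinearMap.ext fun x => (q.2.1 (D.counit d) c x).symm) (E.coact c)).trans
      (congrArg q.1 (E.evalRight_counit c))
  mul_smul v w q := Subtype.ext <| LinearMap.ext fun c => by
    have h₁ : ∀ z, actQAux q (w.unop * v.unop) z =
        actQMul q w.unop v.unop (BTensor.map LinearMap.id D.comul z) :=
      BTensor.eq_of_tmul _ _ (fun x y => map_add _ _ _) (fun x y => by simp only [map_add])
        (fun c d => rfl)
    have h₂ : ∀ z, actQAux ⟨actQ E q w.unop, actQ_mem E q w.unop⟩ v.unop z =
        actQMul q w.unop v.unop (BTensor.assoc C D D (BTensor.map E.coactL LinearMap.id z)) :=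
      BTensor.eq_of_tmul _ _ (fun x y => map_add _ _ _) (fun x y => by simp only [map_add])
        fun c d => BTensor.eq_of_tmul (fun y => op (v.unop.1 d) • actQAux q w.unop y)
          (fun y => actQMul q w.unop v.unop (BTensor.assoc C D D (BTensor.tmul L y d)))
          (fun x y => by rw [map_add, smul_add])
          (fun x y => by simp only [BTensor.add_tmul, map_add])
          (fun c e => (mul_smul (op (v.unop.1 d)) (op (w.unop.1 e)) (q.1 c)).symm) (E.coact c)
    exact (h₁ _).trans ((congrArg (actQMul q w.unop v.unop) (E.coassoc c).symm).trans
      (h₂ _).symm)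
  smul_zero v := Subtype.ext <| LinearMap.ext fun c =>
    BTensor.eq_of_tmul (fun z => actQAux (0 : S.Qt) v.unop z) (fun z => 0)
      (fun x y => map_add _ _ _) (fun x y => (add_zero 0).symm)
      (fun c d => smul_zero (op (v.unop.1 d))) (E.coact c)
  smul_add v q q' := Subtype.ext <| LinearMap.ext fun c =>
    BTensor.eq_of_tmul (fun z => actQAux (q + q') v.unop z)
      (fun z => actQAux q v.unop z + actQAux q' v.unop z)
      (fun x y => map_add _ _ _) (fun x y => by rw [map_add, map_add]; abel)
      (fun c d => smul_add (op (v.unop.1 d)) (q.1 c) (q'.1 c)) (E.coact c)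
  add_smul v w q := Subtype.ext <| LinearMap.ext fun c =>
    BTensor.eq_of_tmul (fun z => actQAux q (v + w).unop z)
      (fun z => actQAux q v.unop z + actQAux q w.unop z)
      (fun x y => map_add _ _ _) (fun x y => by rw [map_add, map_add]; abel)
      (fun c d => add_smul (op (v.unop.1 d)) (op (w.unop.1 d)) (q.1 c)) (E.coact c)
  zero_smul q := Subtype.ext <| LinearMap.ext fun c =>
    BTensor.eq_of_tmul (fun z => actQAux q (unop 0) z) (fun z => 0)
      (fun x y => map_add _ _ _) (fun x y => (add_zero 0).symm)
      (fun c d => zero_smul (S.T)ᵐᵒᵖ (q.1 c)) (E.coact c)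

/-! #### The connecting map -/

/-- The left `C`-colinear right `D`-colinear endomorphisms of `C`. -/
def endCD : AddSubgroup (C →ₗ[A] C) where
  carrier := {u | (∀ c, BTensor.map LinearMap.id u (C.comul c) = C.comul (u c)) ∧
    ∃ u' : C →ₗ[Lᵐᵒᵖ] C, (∀ c, u' c = u c) ∧
      ∀ c, BTensor.map u' LinearMap.id (E.coact c) = E.coact (u c)}
  add_mem' {u w} := by
    rintro ⟨hu, u', hu', hu''⟩ ⟨hw, w', hw', hw''⟩
    refine ⟨fun c => ?_, u' + w', fun c => ?_, fun c => ?_⟩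
    · rw [LinearMap.add_apply, map_add, ← hu, ← hw]
      exact BTensor.eq_of_tmul (fun z => BTensor.map LinearMap.id (u + w) z)
        (fun z => BTensor.map LinearMap.id u z + BTensor.map LinearMap.id w z)
        (fun x y => map_add _ _ _) (fun x y => by rw [map_add, map_add]; abel)
        (fun c d => BTensor.tmul_add c (u d) (w d)) _
    · rw [LinearMap.add_apply, LinearMap.add_apply, hu', hw']
    · rw [BTensor.map_add_left, hu'', hw'', LinearMap.add_apply, map_add]
  zero_mem' := by
    refine ⟨fun c => ?_, 0, fun c => rfl, fun c => ?_⟩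
    · rw [LinearMap.zero_apply, map_zero]
      exact BTensor.eq_of_tmul (fun z => BTensor.map LinearMap.id (0 : C →ₗ[A] C) z)
        (fun z => (0 : BTensor A C C))
        (fun x y => map_add _ _ _) (fun x y => (add_zero 0).symm)
        (fun c d => (by
          have h := BTensor.tmul_add (R := A) c (0 : C) 0
          rwa [add_zero, left_eq_add] at h)) _
    · rw [BTensor.map_zero_left, LinearMap.zero_apply, map_zero]
  neg_mem' {u} := by
    rintro ⟨hu, u', hu', hu''⟩
    refine ⟨fun c => ?_, -u', fun c => ?_, fun c => ?_⟩
    · rw [LinearMap.neg_apply, map_neg, ← hu]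
      refine BTensor.eq_of_tmul (fun z => BTensor.map LinearMap.id (-u) z)
        (fun z => -BTensor.map LinearMap.id u z)
        (fun x y => map_add _ _ _) (fun x y => by rw [map_add, neg_add])
        (fun c d => ?_) _
      have h := map_neg (AddMonoidHom.mk' (BTensor.tmul A c) (BTensor.tmul_add c)) (u d)
      exact h
    · rw [LinearMap.neg_apply, LinearMap.neg_apply, hu']
    · rw [BTensor.map_neg_left, hu'', LinearMap.neg_apply, map_neg]

variable {E}

/-- The left `A`-linear map `C ⊗_L D → A`, `c ⊗ d ↦ q(c)(p(d))`. -/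
def pairing (q : S.Qt) (p : homLD hE S) : BTensor L C D →ₗ[A] A where
  toFun := BTensor.lift (fun c d => q.1 c (show S from p.1 d))
    (fun c c' d => by rw [map_add, LinearMap.add_apply])
    (fun c d d' => (congrArg (q.1 c) (map_add p.1 d d')).trans (map_add (q.1 c) _ _))
    (fun l c d => (q.2.1 l c _).trans (congrArg (q.1 c) (p.2.1 l d).symm))
  map_add' := map_add _
  map_smul' a := BTensor.eq_of_tmul _ _ (fun x y => by rw [smul_add, map_add])
    (fun x y => by rw [map_add, smul_add])
    (fun c d => congrArg (fun f : S →ₗ[Aᵐᵒᵖ] A => f (show S from p.1 d)) (map_smul q.1 a c))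

/-- `c ↦ c^{(1)} q(c^{(2)}_{[0]})(p(c^{(2)}_{[1]}))`. -/
def diamondLin (q : S.Qt) (p : homLD hE S) : C →ₗ[A] C :=
  (evalRightL ((pairing q p).comp E.coact)).comp C.comul

/-- The right `L`-linear map `C ⊗_L D → C`, `c ⊗ d ↦ q(c)(p(d)^{[0]}) p(d)^{[1]}`. -/
def diamondAux (q : S.Qt) (p : homLD hE S) : BTensor L C D →ₗ[Lᵐᵒᵖ] C where
  toFun := BTensor.lift (fun c d => BTensor.evalLeft (q.1 c) (S.coact (show S from p.1 d)))
    (fun c c' d => by rw [map_add, evalLeft_add])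
    (fun c d d' => (congrArg (fun x : S => BTensor.evalLeft (q.1 c) (S.coact x))
      (map_add p.1 d d')).trans
        ((congrArg _ (map_add S.coact _ _)).trans (map_add _ _ _)))
    (fun l c d => by
      refine (q.2.2 _ _).symm.trans (Eq.trans ?_ (q.2.2 _ _))
      rw [E.comul_op_smul]
      refine BTensor.eq_of_tmul
        (fun z => BTensor.evalRight (evalAt q.1 (show S from p.1 d)) (op l • z))
        (fun z => BTensor.evalRight (evalAt q.1 (show S from p.1 (l • d))) z)
        (fun x y => by rw [smul_add, map_add]) (fun x y => map_add _ _ _)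
        (fun c c' => ?_) _
      refine congrArg (fun a : A => op a • c) ?_
      exact (q.2.1 l c' _).trans (congrArg (q.1 c') (p.2.1 l d).symm))
  map_add' := map_add _
  map_smul' l := BTensor.eq_of_tmul _ _ (fun x y => by rw [smul_add, map_add])
    (fun x y => by rw [map_add, smul_add])
    (fun c d => by
      refine (congrArg (BTensor.evalLeft (q.1 c)) ((congrArg (E.rho S.toComod)
        (map_smul p.1 l d)).trans (map_smul (E.rho S.toComod) l (p.1 d)))).trans ?_
      exact BTensor.eq_of_tmul (fun z : BTensor A S C => BTensor.evalLeft (q.1 c) (l • z))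
        (fun z => l • BTensor.evalLeft (q.1 c) z)
        (fun x y => by rw [smul_add, map_add]) (fun x y => by rw [map_add, smul_add])
        (fun x c' => smul_comm (q.1 c x) l c') (S.coact (show S from p.1 d)))

/-- The two forms of the connecting map agree. -/
theorem diamondLin_eq (q : S.Qt) (p : homLD hE S) (c : C) :
    diamondLin q p c = diamondAux q p (E.coact c) := by
  have h₁ : ∀ z : BTensor A C C, BTensor.evalRight ((pairing q p).comp E.coact) z =
      BTensor.evalRight (pairing q p) (BTensor.map LinearMap.id E.coact z) :=
    BTensor.eq_of_tmul _ _ (fun x y => map_add _ _ _) (fun x y => by rw [map_add, map_add])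
      (fun c c' => rfl)
  have h₂ : ∀ z, BTensor.evalRight (pairing q p)
      (BTensor.assoc C C D (BTensor.map E.comulL LinearMap.id z)) = diamondAux q p z :=
    BTensor.eq_of_tmul _ _ (fun x y => by simp only [map_add]) (fun x y => map_add _ _ _)
      (fun c d => (BTensor.eq_of_tmul
        (fun y => BTensor.evalRight (pairing q p) (BTensor.assoc C C D (BTensor.tmul L y d)))
        (fun y => BTensor.evalRight (evalAt q.1 (show S from p.1 d)) y)
        (fun x y => by simp only [BTensor.add_tmul, map_add]) (fun x y => map_add _ _ _)
        (fun c c' => rfl) (C.comul c)).trans (q.2.2 c _))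
  refine (h₁ (C.comul c)).trans (Eq.trans ?_ (h₂ (E.coact c)))
  exact congrArg (BTensor.evalRight (pairing q p)) (E.comul_coact c).symm

theorem diamondLin_mem (q : S.Qt) (p : homLD hE S) : diamondLin q p ∈ endCD E := by
  refine ⟨fun c => ?_, (diamondAux q p).comp E.coactL, fun c => (diamondLin_eq q p c).symm,
    fun c => ?_⟩
  · exact (coact_evalRight ⟨C, C.comulR, C.coassoc, C.evalRight_counit⟩
      ((pairing q p).comp E.coact) c).symm
  · have key : ∀ z, E.coact (diamondAux q p z) = BTensor.map (diamondAux q p) LinearMap.id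
        ((BTensor.assoc C D D).symm (BTensor.map LinearMap.id D.comul z)) := by
      refine BTensor.eq_of_tmul _ _ (fun x y => by simp only [map_add])
        (fun x y => by simp only [map_add]) (fun c d => ?_)
      have k₁ := BTensor.eq_of_tmul
        (fun z : BTensor A S C => E.coact (BTensor.evalLeft (q.1 c) z))
        (fun z => BTensor.evalLeft (q.1 c) (BTensor.map LinearMap.id E.coact z))
        (fun x y => by simp only [map_add]) (fun x y => by simp only [map_add])
        (fun x c' => map_smul E.coact (q.1 c x) c') (S.coact (show S from p.1 d))
      have k₂ : BTensor.map LinearMap.id E.coact (S.coact (show S from p.1 d)) =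
          BTensor.assoc S C D (BTensor.map ((E.rho S.toComod).comp p.1) LinearMap.id
            (D.comul d)) := by
        apply (BTensor.assoc S C D).symm.injective
        rw [AddEquiv.symm_apply_apply]
        refine (map_rho_tau hE S.toComod (p.1 d)).symm.trans ?_
        rw [p.2.2, BTensor.map_map]
        rfl
      have k₃ := BTensor.eq_of_tmul
        (fun z => BTensor.evalLeft (q.1 c) (BTensor.assoc S C D
          (BTensor.map ((E.rho S.toComod).comp p.1) LinearMap.id z)))
        (fun z => BTensor.map (diamondAux q p) LinearMap.id
          ((BTensor.assoc C D D).symm (BTensor.tmul L c z)))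
        (fun x y => by simp only [map_add])
        (fun x y => by simp only [BTensor.tmul_add, map_add])
        (fun a b => BTensor.eq_of_tmul
          (fun z : BTensor A S C => BTensor.evalLeft (q.1 c) (BTensor.assoc S C D
            (BTensor.tmul L z b)))
          (fun z => BTensor.tmul L (BTensor.evalLeft (q.1 c) z) b)
          (fun x y => by simp only [BTensor.add_tmul, map_add])
          (fun x y => by simp only [BTensor.add_tmul, map_add])
          (fun x c' => rfl) (S.coact (show S from p.1 a))) (D.comul d)
      exact k₁.trans ((congrArg (BTensor.evalLeft (q.1 c)) k₂).trans k₃)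
    rw [diamondLin_eq, key, ← E.coassoc, AddEquiv.symm_apply_apply, BTensor.map_map]
    rfl

variable (hE S) in
/-- The connecting map `Q̃ ⊗ _L Hom^D(D, S) → ^C End^D(C)`, where the tensor product is over
`_L Hom_L(D, T)`, given by `(q ⊗ p)(c) = c^{(1)} q(c^{(2)}_{[0]})(p(c^{(2)}_{[1]}))`. -/
def diamond :
    letI : Module (S.homLL D)ᵐᵒᵖ S.Qt := QtModule E
    BTensor (S.homLL D) S.Qt (homLD hE S) →+ endCD E :=
  letI : Module (S.homLL D)ᵐᵒᵖ S.Qt := QtModule E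
  BTensor.lift (fun q p => ⟨diamondLin q p, diamondLin_mem q p⟩)
    (fun q q' p => Subtype.ext <| LinearMap.ext fun c => by
      have h := evalRight_add (f := (pairing q p).comp E.coact) (g := (pairing q' p).comp E.coact)
        (C.comul c)
      refine Eq.trans ?_ h
      refine congrArg (fun f => BTensor.evalRight f (C.comul c)) (LinearMap.ext fun c => ?_)
      exact BTensor.eq_of_tmul (fun z => pairing (q + q') p z)
        (fun z => pairing q p z + pairing q' p z) (fun x y => map_add _ _ _)
        (fun x y => by rw [map_add, map_add]; abel) (fun c d => rfl) (E.coact c))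
    (fun q p p' => Subtype.ext <| LinearMap.ext fun c => by
      have h := evalRight_add (f := (pairing q p).comp E.coact) (g := (pairing q p').comp E.coact)
        (C.comul c)
      refine Eq.trans ?_ h
      refine congrArg (fun f => BTensor.evalRight f (C.comul c)) (LinearMap.ext fun c => ?_)
      exact BTensor.eq_of_tmul (fun z => pairing q (p + p') z)
        (fun z => pairing q p z + pairing q p' z) (fun x y => map_add _ _ _)
        (fun x y => by rw [map_add, map_add]; abel) (fun c d => map_add (q.1 c) _ _) (E.coact c))
    (fun v q p => Subtype.ext <| LinearMap.ext fun c => by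
      refine congrArg (fun f => BTensor.evalRight f (C.comul c)) (LinearMap.ext fun c => ?_)
      let F : BTensor L C (BTensor L D D) →+ A :=
        BTensor.lift (fun c z => q.1 c (show S from actAux v p z))
          (fun c c' z => by rw [map_add, LinearMap.add_apply])
          (fun c z z' => (congrArg (q.1 c) (map_add (actAux v p) z z')).trans
            (map_add (q.1 c) _ _))
          (fun l c z => (q.2.1 l c _).trans (congrArg (q.1 c) (actAux_smul v p l z).symm))
      have h₁ : ∀ z, pairing (op v • q) p z =
          F (BTensor.assoc C D D (BTensor.map E.coactL LinearMap.id z)) :=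
        BTensor.eq_of_tmul _ _ (fun x y => map_add _ _ _) (fun x y => by simp only [map_add])
          (fun c d => BTensor.eq_of_tmul (fun y => actQAux q v y (show S from p.1 d))
            (fun y => F (BTensor.assoc C D D (BTensor.tmul L y d)))
            (fun x y => by rw [map_add, LinearMap.add_apply])
            (fun x y => by simp only [BTensor.add_tmul, map_add])
            (fun c e => rfl) (E.coact c))
      have h₂ : ∀ z, pairing q (v • p) z = F (BTensor.map LinearMap.id D.comul z) :=
        BTensor.eq_of_tmul _ _ (fun x y => map_add _ _ _) (fun x y => by simp only [map_add])
          (fun c d => rfl)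
      exact (h₁ _).trans ((congrArg F (E.coassoc c)).trans (h₂ _).symm))

end Bicomod

end

end CoringMorita

open CoringMorita

/-! Surjectivity of the connecting map enters only through one element: the identity of `C` is
colinear on both sides, so it is a finite sum of maps `q_i ⬧ p_i`. Such a family plays the role of a
dual basis, and explicit two-sided inverses of `can_N` and of the evaluation `ε_M` are written down
from it.

For `q` in `Q̃`, an element `n ⊗ c` of `N ⊗_A C` gives the `A`-linear map `x ↦ n q(c)(x)`, its slice
by `q`. Splitting `c` by the `D`-coaction of `C` gives `Θ(n ⊗ c) = Σ n q_i(c_[0])(-) ⊗_T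
p_i(c_[1])`. By `can_sliceTensor`, `can_N ∘ Θ` is `N ⊗ Σ (q_i ⬧ p_i)`, the identity. For a comodule
`M`, the slice of `ϱ(m)` is colinear (`slice_coact_comm`, a consequence of the identity that defines
`Q̃`). Writing `τ_M(m) = m_[0] ⊗ m_[1]`, which exists by purity, the map `θ(m) = Σ slice_i(ϱ(m_[0]))
⊗_T p_i(m_[1])` therefore takes values in `Hom^C(S, M) ⊗_T S`. Evaluating it gives `m^[0] ε(m^[1]) =
m` (`evAdd_colinTensor_tau`).

The composites in the other order rest on one observation. For `y` in `S` the slice `t` of `ϱ(y)` is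
colinear, hence an element of `T`, and the slice of `(φ ⊗ C)ϱ(y)` is `φ ∘ t`. So `t` crosses the
tensor sign, `φ t ⊗ p(d) = φ ⊗ t(p(d))`. When `y ⊗ d` runs through `τ_S(x)`, the right-hand factors
add up to `x`, which is the evaluation formula for `M = S`. This gives `sliceTensor_can` and
`colinTensor_tau_lin`, and with them `isGalois_of_surjective` and `bijective_evAdd_of_surjective`.

The rest is formal. A right adjoint with invertible counit is fully faithful, and the relation
`can_M ∘ incl = ϱ ∘ ε_M` of `can_incl`, with `ϱ` and `ε_M` injective, gives both the injectivity of
`incl` and the formula for the inverse. -/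

namespace CoringMorita

noncomputable section

namespace Bicomod

open RightExtension

variable {A L : Type u} [Ring A] [Ring L] {C : Coring A} {D : Coring L}
  [Module Lᵐᵒᵖ C] [SMulCommClass A Lᵐᵒᵖ C] {E : RightExtension C D} {hE : E.IsPure}
  {S : Bicomod L C}

/-! ### Slices by elements of `Q̃`, and the right inverse of `can_N` -/

section Slice

variable {N N' : Type u} [AddCommGroup N] [Module Aᵐᵒᵖ N] [AddCommGroup N'] [Module Aᵐᵒᵖ N']

/-- `ε(c^{(1)} q(c^{(2)}_{[0]})(p(c^{(2)}_{[1]}))) = q(c_{[0]})(p(c_{[1]}))`. -/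
theorem counit_diamondLin (q : S.Qt) (p : homLD hE S) (c : C) :
    C.counit (diamondLin q p c) = pairing q p (E.coact c) := by
  -- With `f = q(-_[0])(p(-_[1]))`, right linearity of `ε` and left linearity of `f` give `ε(c f(d))
  -- = ε(c) f(d) = f(ε(c) d)`. The left counit law then collapses `c^(1) ⊗ c^(2)`.
  have h : ∀ z : BTensor A C C, C.counit (BTensor.evalRight ((pairing q p).comp E.coact) z) =
      (pairing q p).comp E.coact (BTensor.evalLeft C.counitR z) :=
    BTensor.eq_of_tmul _ _ (fun x y => by rw [map_add, map_add])
      (fun x y => by rw [map_add, map_add])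
      (fun c d => (C.counit_op_smul _ c).trans
        (map_smul ((pairing q p).comp E.coact) (C.counit c) d).symm)
  exact (h (C.comul c)).trans
    (congrArg ((pairing q p).comp E.coact) (C.evalLeft_counit c))

variable (N) in
/-- The map `N ⊗_A C → Hom_A(S, N)`, `n ⊗ c ↦ (x ↦ n q(c)(x))`. -/
def slice (q : S.Qt) : BTensor A N C →+ (S →ₗ[Aᵐᵒᵖ] N) :=
  AddMonoidHom.mk' (fun z =>
    { toFun := fun x => BTensor.evalRight (evalAt q.1 x) z
      map_add' := fun x y => BTensor.eq_of_tmul _ (fun z =>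
        BTensor.evalRight (evalAt q.1 x) z + BTensor.evalRight (evalAt q.1 y) z)
        (fun z w => map_add _ _ _) (fun z w => by rw [map_add, map_add]; abel)
        (fun n c => (congrArg (fun a => op a • n) (map_add (q.1 c) x y)).trans
          (add_smul (op (q.1 c x)) (op (q.1 c y)) n)) z
      map_smul' := fun a x => BTensor.eq_of_tmul
        (fun z => BTensor.evalRight (evalAt q.1 (a • x)) z)
        (fun z => a • BTensor.evalRight (evalAt q.1 x) z)
        (fun z w => map_add _ _ _) (fun z w => by rw [map_add, smul_add])
        (fun n c => (congrArg (fun b => op b • n) (map_smul (q.1 c) a x)).trans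
          (mul_smul a (op (q.1 c x)) n)) z })
    (fun z w => LinearMap.ext fun x => map_add (BTensor.evalRight (evalAt q.1 x)) z w)

/-- Right `L`-linearity of `q` reads `q(c l)(x) = q(c)(l x)`, so acting by `l` on the factor `C` is
precomposition with the element `S.unit l` of `T`. This is what makes slicing compatible with
tensoring over `L`. -/
theorem slice_op_smul (q : S.Qt) (l : L) (z : BTensor A N C) :
    slice N q (op l • z) = op (S.unit l) • slice N q z :=
  LinearMap.ext fun x => BTensor.eq_of_tmul (fun z => slice N q (op l • z) x)
    (fun z => slice N q z (l • x))
    (fun z w => by rw [smul_add, map_add, LinearMap.add_apply])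
    (fun z w => by rw [map_add, LinearMap.add_apply])
    (fun n c => congrArg (fun a => op a • n) (q.2.1 l c x)) z

/-- Naturality of slicing in the coefficient module, since `f(n q(c)(x)) = f(n) q(c)(x)`. It is used
with `f` a comodule map and with `f = φ : S → N` merely `A`-linear. -/
theorem slice_map (q : S.Qt) (f : N →ₗ[Aᵐᵒᵖ] N') (z : BTensor A N C) :
    slice N' q (BTensor.map f LinearMap.id z) = f.comp (slice N q z) :=
  LinearMap.ext fun x => BTensor.eq_of_tmul
    (fun z => slice N' q (BTensor.map f LinearMap.id z) x) (fun z => f (slice N q z x))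
    (fun z w => by rw [map_add, map_add, LinearMap.add_apply])
    (fun z w => by rw [map_add, LinearMap.add_apply, map_add])
    (fun n c => (map_smul f (op (q.1 c x)) n).symm) z

/-- `n q(c)(x) ⊗ c' = n ⊗ q(c)(x) c'`. -/
theorem map_slice_tmul (q : S.Qt) (n : N) (c : C) (w : BTensor A S C) :
    BTensor.map (slice N q (BTensor.tmul A n c)) LinearMap.id w =
      BTensor.tmul A n (BTensor.evalLeft (q.1 c) w) :=
  BTensor.eq_of_tmul (fun w => BTensor.map (slice N q (BTensor.tmul A n c)) LinearMap.id w)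
    (fun w => BTensor.tmul A n (BTensor.evalLeft (q.1 c) w))
    (fun x y => map_add _ _ _) (fun x y => by rw [map_add, BTensor.tmul_add])
    (fun x c' => BTensor.smul_tmul (q.1 c x) n c') w

variable (N) in
/-- The map `(N ⊗_A C) ⊗_L D → Hom_A(S, N) ⊗_T S`, `(n ⊗ c) ⊗ d ↦ n q(c)(-) ⊗ p(d)`. -/
def sliceTensor (q : S.Qt) (p : homLD hE S) :
    BTensor L (BTensor A N C) D →+ BTensor S.T (S →ₗ[Aᵐᵒᵖ] N) S :=
  BTensor.lift (fun z d => BTensor.tmul S.T (N := S) (slice N q z) (p.1 d))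
    (fun z w d => (congrArg (fun ψ => BTensor.tmul S.T (N := S) ψ (p.1 d))
      (map_add (slice N q) z w)).trans (BTensor.add_tmul _ _ _))
    (fun z d e => (congrArg (BTensor.tmul S.T (N := S) (slice N q z)) (map_add p.1 d e)).trans
      (BTensor.tmul_add _ _ _))
    -- Balancedness over `L`: the scalar `l` turns into `S.unit l` in `T`, crosses the tensor sign
    -- over `T`, and is absorbed by the left `L`-linear map `p`.
    (fun l z d => by
      rw [slice_op_smul]
      refine (BTensor.smul_tmul (N := S) (S.unit l) (slice N q z) (p.1 d)).trans ?_
      exact congrArg (BTensor.tmul S.T (N := S) (slice N q z)) (p.2.1 l d).symm)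

variable (N) in
/-- The map `(N ⊗_A C) ⊗_L D → N`, `(n ⊗ c) ⊗ d ↦ n q(c)(p(d))`. -/
def sliceEval (q : S.Qt) (p : homLD hE S) : BTensor L (BTensor A N C) D →+ N :=
  BTensor.lift (fun z d => slice N q z (show S from p.1 d))
    (fun z w d => by rw [map_add, LinearMap.add_apply])
    (fun z d e => (congrArg (slice N q z) (map_add p.1 d e)).trans (map_add _ _ _))
    (fun l z d => by
      rw [slice_op_smul]
      exact congrArg (slice N q z) (p.2.1 l d).symm)

/-- `can_N` sends `n q(c_{[0]})(-) ⊗ p(c_{[1]})` to `n ⊗ (q ⬧ p)(c)`. -/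
theorem can_sliceTensor (q : S.Qt) (p : homLD hE S) (z : BTensor A N C) :
    Comod.can S.toComod N (sliceTensor N q p
      ((BTensor.assoc N C D).symm (BTensor.map LinearMap.id E.coact z))) =
      BTensor.map LinearMap.id (diamondLin q p) z := by
  refine BTensor.eq_of_tmul (fun z => Comod.can S.toComod N (sliceTensor N q p
    ((BTensor.assoc N C D).symm (BTensor.map LinearMap.id E.coact z))))
    (fun z => BTensor.map LinearMap.id (diamondLin q p) z)
    (fun x y => by simp only [map_add]) (fun x y => map_add _ _ _) (fun n c => ?_) z
  -- Since `can_N` applies the coaction of `S` to `p(c_[1])`, the form of `q ⬧ p` needed here is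
  -- `q(c_[0])(p(c_[1])^[0]) p(c_[1])^[1]`. What remains is to move a scalar across the tensor sign
  -- over `A`.
  refine Eq.trans ?_ (congrArg (BTensor.tmul A n) (diamondLin_eq q p c).symm)
  exact BTensor.eq_of_tmul (fun y => Comod.can S.toComod N (sliceTensor N q p
    ((BTensor.assoc N C D).symm (BTensor.tmul A n y))))
    (fun y => BTensor.tmul A n (diamondAux q p y))
    (fun x y => by simp only [BTensor.tmul_add, map_add])
    (fun x y => by rw [map_add, BTensor.tmul_add])
    (fun c d => map_slice_tmul q n c (S.coact (show S from p.1 d))) (E.coact c)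

/-- On `n ⊗ c` the left side is `n q(c_[0])(p(c_[1]))`, and `counit_diamondLin` recognises the
scalar as `ε((q ⬧ p)(c))`. For `q ⬧ p` replaced by the identity of `C` and `z = ϱ(m)`, the right
side would be `m` itself. -/
theorem sliceEval_coact (q : S.Qt) (p : homLD hE S) (z : BTensor A N C) :
    sliceEval N q p ((BTensor.assoc N C D).symm (BTensor.map LinearMap.id E.coact z)) =
      BTensor.evalRight (C.counit.comp (diamondLin q p)) z := by
  refine BTensor.eq_of_tmul (fun z => sliceEval N q p
    ((BTensor.assoc N C D).symm (BTensor.map LinearMap.id E.coact z)))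
    (fun z => BTensor.evalRight (C.counit.comp (diamondLin q p)) z)
    (fun x y => by simp only [map_add]) (fun x y => map_add _ _ _) (fun n c => ?_) z
  refine Eq.trans ?_ (congrArg (fun a : A => op a • n) (counit_diamondLin q p c).symm)
  exact BTensor.eq_of_tmul (fun y => sliceEval N q p
    ((BTensor.assoc N C D).symm (BTensor.tmul A n y))) (fun y => op (pairing q p y) • n)
    (fun x y => by simp only [BTensor.tmul_add, map_add])
    (fun x y => by rw [map_add, MulOpposite.op_add, add_smul]) (fun c d => rfl) (E.coact c)

end Slice

/-! ### Slices of coactions are colinear; the inverse of the evaluation map -/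

section Colinear

variable {M : Comod C}

/-- For `q` in `Q̃` and `m` in `M`, the map `x ↦ m^{[0]} q(m^{[1]})(x)` is colinear. -/
theorem slice_coact_comm (q : S.Qt) (m : M) (x : S) :
    BTensor.map (slice M q (M.coact m)) LinearMap.id (S.coact x) =
      M.coact (slice M q (M.coact m) x) := by
  -- Coassociativity of `M` rewrites `ϱ(m^[0] q(m^[1])(x))` as `m^[0] ⊗ m^[1](1) q(m^[1](2))(x)`.
  -- After that only `ϱ(m)` occurs, and it may be replaced by an arbitrary `z` in `M ⊗_A C`; on `z =
  -- m ⊗ c` the equality is the identity that defines `Q̃`.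
  refine Eq.trans ?_ (coact_evalRight M (evalAt q.1 x) m).symm
  refine BTensor.eq_of_tmul
    (fun z => BTensor.map (slice M q z) (LinearMap.id : C →ₗ[A] C) (S.coact x))
    (fun z => BTensor.map LinearMap.id ((evalRightL (evalAt q.1 x)).comp C.comul) z)
    (fun z w => by rw [map_add, BTensor.map_add_left]) (fun z w => map_add _ _ _)
    (fun m c => ?_) (M.coact m)
  exact (map_slice_tmul q m c (S.coact x)).trans
    (congrArg (BTensor.tmul A m) (q.2.2 c x).symm)

variable (E M) in
/-- The map `M → Hom^C(S, M)`, `m ↦ (x ↦ m^{[0]} q(m^{[1]})(x))`. -/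
def colinSlice (q : S.Qt) : E.Res M →+ (S.toComod ⟶ M) :=
  AddMonoidHom.mk' (fun m : M => Comod.ofLin (slice M q (M.coact m)) (slice_coact_comm q m))
    (fun m m' : M => Comod.hom_ext fun x =>
      DFunLike.congr_fun ((congrArg (slice M q) (map_add M.coact m m')).trans
        (map_add (slice M q) _ _)) x)

/-- The coaction `ϱ` is right `L`-linear for the `L`-module structure of `M`, so `slice_op_smul`
applies. The composite on the right is the action of `S.unit l`, as an element of `T`, on `Hom^C(S,
M)`. -/
theorem colinSlice_op_smul (q : S.Qt) (l : L) (m : E.Res M) :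
    colinSlice E M q (op l • m) = S.unit l ≫ colinSlice E M q m :=
  Comod.lin_injective ((congrArg (slice M q) (map_smul (E.rho M) (op l) m)).trans
    (slice_op_smul q l (E.rho M m)))

/-- Colinearity of `f` turns `ϱ(f(m))` into `(f ⊗ C)ϱ(m)`, and slicing is natural. For `M = S` the
map `colinSlice E S.toComod q m` lies in `T`, so the right side is `f` acted on by an element of
`T`; this is what allows it to cross the tensor sign. -/
theorem colinSlice_lin {M' : Comod C} (q : S.Qt) (f : M ⟶ M') (m : E.Res M) :
    colinSlice E M' q (E.resMap f m) = colinSlice E M q m ≫ f :=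
  Comod.lin_injective ((congrArg (slice M' q) (Comod.lin_comm f m).symm).trans
    (slice_map q (Comod.lin f) (M.coact m)))

variable (M) in
/-- The map `M ⊗_L D → Hom^C(S, M) ⊗_T S`, `m ⊗ d ↦ m^{[0]} q(m^{[1]})(-) ⊗ p(d)`. -/
def colinTensor (q : S.Qt) (p : homLD hE S) :
    BTensor L (E.Res M) D →+ BTensor S.T (S.toComod ⟶ M) S :=
  BTensor.lift (fun m d => BTensor.tmul S.T (N := S) (colinSlice E M q m) (p.1 d))
    (fun m m' d => (congrArg (fun ψ => BTensor.tmul S.T (N := S) ψ (p.1 d))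
      (map_add (colinSlice E M q) m m')).trans (BTensor.add_tmul _ _ _))
    (fun m d e => (congrArg (BTensor.tmul S.T (N := S) (colinSlice E M q m)) (map_add p.1 d e)).trans
      (BTensor.tmul_add _ _ _))
    (fun l m d => by
      rw [colinSlice_op_smul]
      refine (BTensor.smul_tmul (N := S) (S.unit l) (colinSlice E M q m) (p.1 d)).trans ?_
      exact congrArg (BTensor.tmul S.T (N := S) (colinSlice E M q m)) (p.2.1 l d).symm)

/-- Evaluation sees only the linear map underlying a colinear slice, hence depends on `w` only
through its image in `(M ⊗_A C) ⊗_L D`. That is the place where `τ_M` is characterised. -/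
theorem evAdd_colinTensor (q : S.Qt) (p : homLD hE S) (w : BTensor L (E.Res M) D) :
    Comod.evAdd S.toComod M (colinTensor M q p w) =
      sliceEval M q p (BTensor.map (E.rho M) LinearMap.id w) :=
  BTensor.eq_of_tmul (fun w => Comod.evAdd S.toComod M (colinTensor M q p w))
    (fun w => sliceEval M q p (BTensor.map (E.rho M) LinearMap.id w))
    (fun x y => by rw [map_add, map_add]) (fun x y => by rw [map_add, map_add])
    (fun m d => rfl) w

/-- No direct formula for `τ_M` is available, only the value of `(ϱ ⊗ D) ∘ τ_M`; by
`evAdd_colinTensor` this value suffices. Besides computing `ε_M ∘ θ`, the case `M = S` identifies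
the right-hand tensor factor in `colinTensor_tau_lin` and `sliceTensor_can`. -/
theorem evAdd_colinTensor_tau (q : S.Qt) (p : homLD hE S) (m : M) :
    Comod.evAdd S.toComod M (colinTensor M q p (tau hE M m)) =
      BTensor.evalRight (C.counit.comp (diamondLin q p)) (M.coact m) := by
  rw [evAdd_colinTensor]
  exact (congrArg (sliceEval M q p) (map_rho_tau hE M m)).trans
    (sliceEval_coact q p (M.coact m))

/-- Naturality of `τ` moves the computation to `τ_S(x)`. There each slice of `φ(y)` is `φ ∘ t` with
`t` in `T` the slice of `y`, so `φ` splits off on the left of the tensor sign, leaving the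
evaluation formula for `S`. -/
theorem colinTensor_tau_lin (q : S.Qt) (p : homLD hE S) (φ : S.toComod ⟶ M) (x : S) :
    colinTensor M q p (tau hE M (Comod.lin φ x)) =
      BTensor.tmul S.T φ (BTensor.evalRight (C.counit.comp (diamondLin q p)) (S.coact x)) := by
  refine Eq.trans ?_ (congrArg (BTensor.tmul S.T φ) (evAdd_colinTensor_tau q p x))
  refine (congrArg (colinTensor M q p) (tau_resMap hE φ x)).trans ?_
  exact BTensor.eq_of_tmul
    (fun w => colinTensor M q p (BTensor.map (E.resMap φ) LinearMap.id w))
    (fun w => BTensor.tmul S.T φ (Comod.evAdd S.toComod S.toComod (colinTensor S.toComod q p w)))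
    (fun x y => by rw [map_add, map_add])
    (fun x y => by rw [map_add, map_add, BTensor.tmul_add])
    -- The element of `T` that crosses is `colinSlice E S.toComod q x`.
    (fun x d => (congrArg (fun ψ => BTensor.tmul S.T (N := S) ψ (p.1 d))
      (colinSlice_lin q φ x)).trans
        (BTensor.smul_tmul (R := S.T) (N := S) (colinSlice E S.toComod q x) φ (p.1 d)))
    (tau hE S.toComod x)

/-- The analogue of `colinTensor_tau_lin` for a map `φ` that is only `A`-linear. There is no
coaction `τ_N`, but the one of `S` is enough: it is through `τ_S`, hence through purity, that slices
of elements `ϱ(y)` appear, and these lie in `T`. -/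
theorem sliceTensor_can {N : Type u} [AddCommGroup N] [Module Aᵐᵒᵖ N] (q : S.Qt)
    (p : homLD hE S) (φ : S →ₗ[Aᵐᵒᵖ] N) (x : S) :
    sliceTensor N q p ((BTensor.assoc N C D).symm (BTensor.map LinearMap.id E.coact
      (BTensor.map φ LinearMap.id (S.coact x)))) =
      BTensor.tmul S.T φ (BTensor.evalRight (C.counit.comp (diamondLin q p)) (S.coact x)) := by
  refine Eq.trans ?_ (congrArg (BTensor.tmul S.T φ) (evAdd_colinTensor_tau q p x))
  -- The element `φ(x^[0]) ⊗ x^[1]_[0] ⊗ x^[1]_[1]` is the image of `τ_S(x)` under `(φ ⊗ C)ϱ ⊗ D`.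
  -- The left tensor factor thus comes from `S` and not merely from `S ⊗_A C`.
  have h₁ : (BTensor.assoc N C D).symm (BTensor.map LinearMap.id E.coact
      (BTensor.map φ LinearMap.id (S.coact x))) =
      BTensor.map ((BTensor.mapR L C φ).comp (E.rho S.toComod)) LinearMap.id
        (tau hE S.toComod x) := by
    have h₂ : BTensor.map (BTensor.mapR L C φ) LinearMap.id (E.preCoact S.toComod x) =
        BTensor.map ((BTensor.mapR L C φ).comp (E.rho S.toComod)) LinearMap.id
          (tau hE S.toComod x) :=
      (congrArg _ (map_rho_tau hE S.toComod x).symm).trans (BTensor.map_map _ _ _ _ _)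
    rw [← h₂, AddEquiv.symm_apply_eq, BTensor.assoc_map, preCoact_apply,
      AddEquiv.apply_symm_apply, BTensor.mapL_id, BTensor.map_map, BTensor.map_map]
    rfl
  rw [h₁]
  exact BTensor.eq_of_tmul
    (fun w => sliceTensor N q p
      (BTensor.map ((BTensor.mapR L C φ).comp (E.rho S.toComod)) LinearMap.id w))
    (fun w => BTensor.tmul S.T φ (Comod.evAdd S.toComod S.toComod (colinTensor S.toComod q p w)))
    (fun x y => by rw [map_add, map_add])
    (fun x y => by rw [map_add, map_add, BTensor.tmul_add])
    -- On `y ⊗ d` the slice is `φ ∘ t` with `t = colinSlice E S.toComod q y` in `T`; `t` crosses the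
    -- tensor sign and acts on `p(d)`.
    (fun y d => (congrArg (fun ψ => BTensor.tmul S.T (N := S) ψ (p.1 d))
      (slice_map q φ (S.coact y))).trans
        (BTensor.smul_tmul (R := S.T) (N := S) (colinSlice E S.toComod q y) φ (p.1 d)))
    (tau hE S.toComod x)

end Colinear

/-! ### Summing over a preimage of the identity of `C` -/

section Surjective

theorem evalRight_counit_add {M : Type*} [AddCommGroup M] [Module Aᵐᵒᵖ M] (u w : C →ₗ[A] C)
    (z : BTensor A M C) :
    BTensor.evalRight (C.counit.comp (u + w)) z =
      BTensor.evalRight (C.counit.comp u) z + BTensor.evalRight (C.counit.comp w) z :=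
  BTensor.eq_of_tmul _
    (fun z => BTensor.evalRight (C.counit.comp u) z + BTensor.evalRight (C.counit.comp w) z)
    (fun x y => map_add _ _ _) (fun x y => by rw [map_add, map_add]; abel)
    (fun m c => (congrArg (fun a => op a • m) (map_add C.counit (u c) (w c))).trans
      (add_smul (op (C.counit (u c))) (op (C.counit (w c))) m)) z

theorem map_id_add {M : Type*} [AddCommGroup M] [Module Aᵐᵒᵖ M] (u w : C →ₗ[A] C)
    (z : BTensor A M C) :
    BTensor.map LinearMap.id (u + w) z =
      BTensor.map LinearMap.id u z + BTensor.map LinearMap.id w z :=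
  BTensor.eq_of_tmul _
    (fun z => BTensor.map LinearMap.id u z + BTensor.map LinearMap.id w z)
    (fun x y => map_add _ _ _) (fun x y => by rw [map_add, map_add]; abel)
    (fun m c => BTensor.tmul_add m (u c) (w c)) z

/-- For `u` in the image of the connecting map, `N ⊗_A u` factors through `can_N`. -/
theorem exists_can_section (N : Type u) [AddCommGroup N] [Module Aᵐᵒᵖ N] :
    letI : Module (S.homLL D)ᵐᵒᵖ S.Qt := QtModule E
    ∀ z : BTensor (S.homLL D) S.Qt (homLD hE S),
      ∃ Θ : BTensor A N C →+ BTensor S.T (S →ₗ[Aᵐᵒᵖ] N) S,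
        (∀ y, Comod.can S.toComod N (Θ y) = BTensor.map LinearMap.id (diamond hE S z).1 y) ∧
        ∀ (φ : S →ₗ[Aᵐᵒᵖ] N) (x : S), Θ (BTensor.map φ LinearMap.id (S.coact x)) =
          BTensor.tmul S.T φ
            (BTensor.evalRight (C.counit.comp (diamond hE S z).1) (S.coact x)) := by
  -- The action on `Q̃` involves the `D`-coaction of `C`, which the type `S.Qt` does not record; it
  -- is therefore installed locally.
  let : Module (S.homLL D)ᵐᵒᵖ S.Qt := QtModule E
  intro z
  induction z using BTensor.induction_on with
  | tmul q p =>
    exact ⟨(sliceTensor N q p).comp ((BTensor.assoc N C D).symm.toAddMonoidHom.comp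
      (BTensor.map LinearMap.id E.coact)), can_sliceTensor q p, sliceTensor_can q p⟩
  -- Both properties are additive in `z`. Asking only that some `Θ` exist for each `z` makes it
  -- unnecessary to check that the construction is balanced over the convolution algebra.
  | add z w hz hw =>
    obtain ⟨Θ, h₁, h₂⟩ := hz
    obtain ⟨Θ', h₁', h₂'⟩ := hw
    have h : (diamond hE S (z + w)).1 = (diamond hE S z).1 + (diamond hE S w).1 :=
      congrArg Subtype.val (map_add (diamond hE S) z w)
    refine ⟨Θ + Θ', fun y => ?_, fun φ x => ?_⟩
    · rw [AddMonoidHom.add_apply, map_add, h₁, h₁', h, map_id_add]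
    · rw [AddMonoidHom.add_apply, h₂, h₂', h, evalRight_counit_add, BTensor.tmul_add]

/-- For a pure tensor the map is `m ↦ m_[0]^[0] q(m_[0]^[1])(-) ⊗ p(m_[1])`, with `τ_M(m) = m_[0] ⊗
m_[1]`; in general it is a sum of such maps. Once `z` maps to the identity of `C`, the counit laws
reduce the two right sides to `m` and `φ ⊗ x`, so `θ` inverts evaluation. -/
theorem exists_ev_section (M : Comod C) :
    letI : Module (S.homLL D)ᵐᵒᵖ S.Qt := QtModule E
    ∀ z : BTensor (S.homLL D) S.Qt (homLD hE S),
      ∃ θ : M →+ BTensor S.T (S.toComod ⟶ M) S,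
        (∀ m, Comod.evAdd S.toComod M (θ m) =
          BTensor.evalRight (C.counit.comp (diamond hE S z).1) (M.coact m)) ∧
        ∀ (φ : S.toComod ⟶ M) (x : S), θ (Comod.lin φ x) =
          BTensor.tmul S.T φ
            (BTensor.evalRight (C.counit.comp (diamond hE S z).1) (S.coact x)) := by
  let : Module (S.homLL D)ᵐᵒᵖ S.Qt := QtModule E
  intro z
  induction z using BTensor.induction_on with
  | tmul q p =>
    exact ⟨(colinTensor M q p).comp (tau hE M), evAdd_colinTensor_tau q p,
      colinTensor_tau_lin q p⟩
  | add z w hz hw =>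
    obtain ⟨θ, h₁, h₂⟩ := hz
    obtain ⟨θ', h₁', h₂'⟩ := hw
    have h : (diamond hE S (z + w)).1 = (diamond hE S z).1 + (diamond hE S w).1 :=
      congrArg Subtype.val (map_add (diamond hE S) z w)
    refine ⟨θ + θ', fun y => ?_, fun φ x => ?_⟩
    · rw [AddMonoidHom.add_apply, map_add, h₁, h₁', h, evalRight_counit_add]
    · rw [AddMonoidHom.add_apply, h₂, h₂', h, evalRight_counit_add, BTensor.tmul_add]

theorem id_mem_endCD (E : RightExtension C D) : LinearMap.id ∈ endCD E :=
  ⟨fun c => BTensor.map_id _, LinearMap.id, fun c => rfl, fun c => BTensor.map_id _⟩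

/-- A preimage of the identity of `C` suffices: the map `Θ` attached to it is a two-sided inverse of
`can_N`, for every `N`. -/
theorem isGalois_of_surjective (h : Function.Surjective (diamond hE S)) : S.toComod.IsGalois := by
  intro N _ _
  obtain ⟨z, hz⟩ := h ⟨LinearMap.id, id_mem_endCD E⟩
  obtain ⟨Θ, h₁, h₂⟩ := exists_can_section N z
  -- With the identity in place of `u`, the first property says `can_N ∘ Θ = id`, and the second
  -- becomes `Θ(can_N(φ ⊗ x)) = φ ⊗ x` by the counit law of `S`.
  simp only [hz, LinearMap.comp_id] at h₁ h₂
  refine Function.bijective_iff_has_inverse.2 ⟨Θ, fun y => ?_, fun y => (h₁ y).trans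
    (BTensor.map_id y)⟩
  exact BTensor.eq_of_tmul (fun y => Θ (Comod.can S.toComod N y)) (fun y => y)
    (fun x y => by rw [map_add, map_add]) (fun x y => rfl)
    (fun φ x => (h₂ φ x).trans (congrArg _ (S.evalRight_counit x))) y

/-- The inverse is built directly from the preimage of the identity, independently of the Galois
property; colinearity of the slices makes it land in `Hom^C(S, M) ⊗_T S`. -/
theorem bijective_evAdd_of_surjective (h : Function.Surjective (diamond hE S)) (M : Comod C) :
    Function.Bijective (Comod.evAdd S.toComod M) := by
  obtain ⟨z, hz⟩ := h ⟨LinearMap.id, id_mem_endCD E⟩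
  obtain ⟨θ, h₁, h₂⟩ := exists_ev_section M z
  simp only [hz, LinearMap.comp_id] at h₁ h₂
  refine Function.bijective_iff_has_inverse.2 ⟨θ, fun y => ?_, fun m => (h₁ m).trans
    (M.evalRight_counit m)⟩
  exact BTensor.eq_of_tmul (fun y => θ (Comod.evAdd S.toComod M y)) (fun y => y)
    (fun x y => by rw [map_add, map_add]) (fun x y => rfl)
    (fun φ x => (h₂ φ x).trans (congrArg _ (S.evalRight_counit x))) y

end Surjective

end Bicomod

/-! ### Invertible comodule maps, and the relation between `can_M` and the counit -/

namespace Comod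

variable {A : Type u} [Ring A] {C : Coring A}

/-- A bijective morphism of comodules is an isomorphism. -/
theorem isIso_of_bijective {M N : Comod C} (f : M ⟶ N) (hf : Function.Bijective (lin f)) :
    IsIso f := by
  let e : M ≃ₗ[Aᵐᵒᵖ] N := LinearEquiv.ofBijective (lin f) hf
  have he : (e.symm : N →ₗ[Aᵐᵒᵖ] M).comp (lin f) = LinearMap.id :=
    LinearMap.ext fun m => e.symm_apply_apply m
  refine ⟨ofLin (e.symm : N →ₗ[Aᵐᵒᵖ] M) fun n => ?_, hom_ext fun m => e.symm_apply_apply m,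
    hom_ext fun n => e.apply_symm_apply n⟩
  -- Colinearity of the inverse is tested on elements `f(m)`, where it follows from colinearity of
  -- `f`.
  obtain ⟨m, rfl⟩ := hf.2 n
  rw [← lin_comm, BTensor.map_map, he]
  exact (BTensor.map_id _).trans (congrArg M.coact (e.symm_apply_apply m).symm)

theorem coact_injective (M : Comod C) : Function.Injective M.coact := fun m m' h => by
  rw [← M.evalRight_counit m, h, M.evalRight_counit]

/-- `can_M ∘ incl = ϱ^M ∘ ε_M`. -/
theorem can_incl (S M : Comod C) (z : (indFunctor S).obj ((homFunctor S).obj M)) :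
    can S M (incl S M z) = M.coact (lin (ev S M) z) :=
  BTensor.eq_of_tmul (M := (homFunctor S).obj M) (N := S)
    (fun z => can S M (incl S M z)) (fun z => M.coact (evAdd S M z))
    (fun x y => (congrArg (can S M) (map_add (BTensor.map _ _) x y)).trans (map_add _ _ _))
    (fun x y => (congrArg M.coact (map_add (evAdd S M) x y)).trans (map_add _ _ _))
    -- On `φ ⊗ x` the relation is exactly the colinearity of `φ`.
    (fun φ x => lin_comm (φ : S ⟶ M) x) z

end Comod

end

end CoringMorita

/-- The map `θ` is a morphism of comodules inverse to the counit. Stating its formula after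
composition with `incl` says at once that `can_M⁻¹ ∘ ϱ` takes values in the image of `incl`; by
injectivity of `incl`, the formula determines `θ`. -/
theorem mainTheorem4 {A L : Type u} [Ring A] [Ring L] {C : Coring A} {D : Coring L}
    [Module Lᵐᵒᵖ C] [SMulCommClass A Lᵐᵒᵖ C] (E : RightExtension C D) (hE : E.IsPure)
    (S : Bicomod L C) (h : Function.Surjective (Bicomod.diamond hE S)) :
    (Comod.homFunctor S.toComod).Full ∧ (Comod.homFunctor S.toComod).Faithful ∧
    ∃ hG : S.toComod.IsGalois, ∀ M : Comod C,
      Function.Injective (Comod.incl S.toComod M) ∧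
      ∃ θ : M ⟶ (Comod.indFunctor S.toComod).obj ((Comod.homFunctor S.toComod).obj M),
        (∀ m : M, Comod.incl S.toComod M (Comod.lin θ m) = Comod.canInv hG M (M.coact m)) ∧
        θ ≫ (Comod.indAdj S.toComod).counit.app M = 𝟙 M ∧
        (Comod.indAdj S.toComod).counit.app M ≫ θ =
          𝟙 ((Comod.indFunctor S.toComod).obj ((Comod.homFunctor S.toComod).obj M)) := by
  have hev : ∀ M : Comod C, IsIso ((Comod.indAdj S.toComod).counit.app M) := fun M =>
    Comod.isIso_of_bijective (Comod.ev S.toComod M) (Bicomod.bijective_evAdd_of_surjective h M)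
  have hG := Bicomod.isGalois_of_surjective h
  have : IsIso (Comod.indAdj S.toComod).counit := NatIso.isIso_of_isIso_app _
  -- A right adjoint whose counit is invertible is fully faithful.
  let F := (Comod.indAdj S.toComod).fullyFaithfulROfIsIsoCounit
  refine ⟨F.full, F.faithful, hG, fun M => ⟨fun x y hxy => ?_, ?_⟩⟩
  -- Since `can_M ∘ incl = ϱ ∘ ε_M` and both maps on the right are injective, `incl` is injective.
  · refine (Bicomod.bijective_evAdd_of_surjective h M).1 (Comod.coact_injective M ?_)
    exact (Comod.can_incl S.toComod M x).symm.trans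
      ((congrArg (Comod.can S.toComod M) hxy).trans (Comod.can_incl S.toComod M y))
  · have := hev M
    refine ⟨inv ((Comod.indAdj S.toComod).counit.app M), fun m => ?_, IsIso.inv_hom_id _,
      IsIso.hom_inv_id _⟩
    -- After applying `can_M` to both sides, the claim reads `ϱ(ε_M(θ(m))) = ϱ(m)`, and `ε_M ∘ θ` is
    -- the identity.
    refine (Equiv.eq_symm_apply _).2 ((Comod.can_incl S.toComod M _).trans ?_)
    refine congrArg M.coact ?_
    exact congrArg (fun f : M ⟶ M => Comod.lin f m)
      (IsIso.inv_hom_id ((Comod.indAdj S.toComod).counit.app M))
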